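/- All graphs are finite. A graph $G$ is $k$-connected ($k\ge 1$) if it has more than $k$ nodes and deleting any $k-1$ nodes leaves a connected graph; $\delta(G)$ denotes the minimum degree. Let $G$ be a simple graph, and let $H$ be a simple graph that is a subdivision of a $3$-connected graph, where the latter may have parallel edges but no self-loops (a subdivision replaces each edge by a path of length at least one, these paths being internally disjoint). For a graph $S$, call a node of $S$ real if its degree in $S$ is at least $3$. A link of $S$ is a path in $S$ of length at least one whose two endnodes are real and whose inner nodes are not; two links are parallel if they have the same endnodes. A BG-path for $S\subseteq G$ is a path $P$ in $G$ with distinct endnodes $x,y$ such that (1) $S\cap P$ consists of exactly the nodes $x,y$ and no edge; (2) no link of $S$ contains both $x$ and $y$, except with both being its endnodes; (3) $x$ and $y$ are not inner nodes of parallel links of $S$. It is basic if no link of $S$ has the endnodes $x$ and $y$ (that is, the corresponding edge addition in the graph obtained from $S$ by smoothing its degree-two nodes creates no parallel edges). An expand operation on $S\subseteq G$ adds to $S$ three paths in $G$ that start at a common node $v\in V(G)\setminus V(S)$, are pairwise disjoint except for $v$, end at three distinct real nodes of $S$, and have all inner nodes in $V(G)\setminus V(S)$. A construction sequence from $H$ to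 $G$ is a sequence $H=S_0,S_1,\dots,S_z=G$ ($z\ge 0$) of subgraphs of $G$ in which each $S_{i+1}$ arises from $S_i$ by one of the permitted operations. Then the following statements are equivalent: (i) $G$ is $3$-connected and $H\subseteq G$; (ii) $\delta(G)\ge 3$ and there is a construction sequence from $H$ to $G$ in which each $S_{i+1}$ is $S_i\cup P$ for a BG-path $P$ for $S_i$; (iii) $\delta(G)\ge 3$ and there is a construction sequence from $H$ to $G$ in which each $S_{i+1}$ arises from $S_i$ by adding a basic BG-path for $S_i$ or by an expand operation. -/

import Mathlib

/-- A simple graph whose nodes are taken from `U`: a node set together with a symmetric, irreflexive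
adjacency relation on it. Different graphs over `U` may have different node sets; `≤`, `⊓`, `⊔` are
subgraph inclusion, intersection and union. -/
abbrev SGraph (U : Type*) := (⊤ : SimpleGraph U).Subgraph

/-- Walks on nodes of `U`. Such a walk `p` lies in a graph `S` if `p.toSubgraph ≤ S`. -/
abbrev NodeWalk {U : Type*} (x y : U) := (⊤ : SimpleGraph U).Walk x y

namespace SGraph

variable {U : Type*}

/-- The degree of a node. -/
noncomputable def deg (S : SGraph U) (v : U) : ℕ∞ := (S.neighborSet v).encard

/-- The minimum degree `δ(S)`. -/
noncomputable def minDeg (S : SGraph U) : ℕ∞ := ⨅ v ∈ S.verts, deg S v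

/-- `k`-connectedness (for `k ≥ 1`): there are more than `k` nodes, and deleting any `k - 1` nodes
leaves a connected graph. -/
def KConnected (k : ℕ) (S : SGraph U) : Prop :=
  (k : ℕ∞) < S.verts.encard ∧
    ∀ X : Set U, X ⊆ S.verts → X.encard + 1 = k → (S.deleteVerts X).Connected

/-- The simple graph underlying a multigraph. -/
def underlying {W F : Type*} (K : Graph W F) : SGraph W where
  verts := K.vertexSet
  Adj x y := x ≠ y ∧ K.Adj x y
  adj_sub h := h.1
  edge_vert h := h.2.left_mem
  symm := ⟨fun _ _ h => ⟨h.1.symm, h.2.symm⟩⟩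

/-- `k`-connectedness of a multigraph: parallel edges and loops are irrelevant. -/
def MultiKConnected {W F : Type*} (k : ℕ) (K : Graph W F) : Prop :=
  KConnected k (underlying K)

/-- `H` is a subdivision of the loopless multigraph `K`: it arises from `K` by replacing every edge
`e` by a path `P e` of length at least one between the ends of `e` (here `φ` embeds the nodes of `K`
into `H`); paths of distinct edges share no edge, and no node except images of nodes of `K`; a path
contains no image of a node of `K` except its ends. The length of each path is at least one because
`K` is loopless. -/
def IsSubdivision {W F : Type*} (H : SGraph U) (K : Graph W F) [K.Loopless] : Prop :=
  ∃ (φ : W → U) (P : F → SGraph U),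
    Set.InjOn φ K.vertexSet ∧
    (∀ e x y, K.IsLink e x y → ∃ p : NodeWalk (φ x) (φ y), p.IsPath ∧ p.toSubgraph = P e) ∧
    (∀ e ∈ K.edgeSet, ∀ z ∈ K.vertexSet, φ z ∈ (P e).verts → K.Inc e z) ∧
    (∀ e ∈ K.edgeSet, ∀ f ∈ K.edgeSet, e ≠ f →
      (P e).verts ∩ (P f).verts ⊆ φ '' K.vertexSet ∧ Disjoint (P e).edgeSet (P f).edgeSet) ∧
    H.verts = φ '' K.vertexSet ∪ ⋃ e ∈ K.edgeSet, (P e).verts ∧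
    ∀ a b, H.Adj a b ↔ ∃ e ∈ K.edgeSet, (P e).Adj a b

/-- The real nodes of `S` are those of degree at least three. -/
def IsReal (S : SGraph U) (v : U) : Prop := v ∈ S.verts ∧ 3 ≤ deg S v

/-- A link of `S` is a path in `S` (of length at least one) whose ends are real and whose inner
nodes are not. -/
def IsSLink (S : SGraph U) {a b : U} (L : NodeWalk a b) : Prop :=
  L.IsPath ∧ 1 ≤ L.length ∧ L.toSubgraph ≤ S ∧ IsReal S a ∧ IsReal S b ∧
    ∀ v ∈ L.support, v ≠ a → v ≠ b → ¬ IsReal S v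

/-- `v` is an inner node of the path `L`. -/
def IsInner (v : U) {a b : U} (L : NodeWalk a b) : Prop := v ∈ L.support ∧ v ≠ a ∧ v ≠ b

/-- `P` is a BG-path for `S` in `G`. -/
structure IsBGPath (G S : SGraph U) {x y : U} (P : NodeWalk x y) : Prop where
  isPath : P.IsPath
  ne : x ≠ y
  le : P.toSubgraph ≤ G
  /-- The intersection of `S` and `P` is the edgeless graph on `{x, y}`. -/
  inter_verts : (S ⊓ P.toSubgraph).verts = {x, y}
  inter_edges : (S ⊓ P.toSubgraph).edgeSet = ∅
  /-- `x` and `y` are not both contained in a link of `S` except as its ends. -/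
  same_link : ∀ (a b : U) (L : NodeWalk a b), IsSLink S L → x ∈ L.support → y ∈ L.support →
    (x = a ∨ x = b) ∧ (y = a ∨ y = b)
  /-- `x` and `y` are not inner nodes of parallel links (links with the same ends) of `S`. -/
  parallel_links : ∀ (a b : U) (L L' : NodeWalk a b), IsSLink S L → IsSLink S L' →
    ¬ (IsInner x L ∧ IsInner y L')

/-- `S'` arises from `S` by adding a BG-path. -/
def BGStep (G S S' : SGraph U) : Prop :=
  ∃ (x y : U) (P : NodeWalk x y), IsBGPath G S P ∧ S' = S ⊔ P.toSubgraph

/-- `S'` arises from `S` by adding a BG-path that is basic, i.e. is not parallel to a link of `S`: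
after smoothing, the edge `xy` is added between nodes that are not yet adjacent. (If `x` or `y` is
an inner node of a link of `S`, it is not the end of any link of `S`, and no parallel edge can
arise.) -/
def BasicBGStep (G S S' : SGraph U) : Prop :=
  ∃ (x y : U) (P : NodeWalk x y), IsBGPath G S P ∧ (∀ L : NodeWalk x y, ¬ IsSLink S L) ∧
    S' = S ⊔ P.toSubgraph

/-- `S'` arises from `S` by an expand operation: add three paths in `G` that start at a node `v`
outside `S`, end at distinct real nodes of `S`, meet `S` only in these ends, and meet each other
only in `v`. -/
def ExpandStep (G S S' : SGraph U) : Prop :=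
  ∃ (v : U) (a : Fin 3 → U) (P : ∀ i, NodeWalk v (a i)),
    v ∉ S.verts ∧ Function.Injective a ∧ (∀ i, IsReal S (a i)) ∧
    (∀ i, (P i).IsPath ∧ (P i).toSubgraph ≤ G ∧ ∀ u ∈ (P i).support, u ∈ S.verts → u = a i) ∧
    (∀ i j, i ≠ j → ∀ u ∈ (P i).support, u ∈ (P j).support → u = v) ∧
    S' = S ⊔ ⨆ i, (P i).toSubgraph

/-- There is a construction sequence `H = S₀, …, S_z = G` (`z ≥ 0`) using BG-paths. -/
def HasConstructionSeq (H G : SGraph U) : Prop :=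
  Relation.ReflTransGen (BGStep G) H G

/-- There is a basic construction sequence `H = S₀, …, S_z = G` (`z ≥ 0`) using BG-paths and the
expand operation. -/
def HasBasicExpandConstructionSeq (H G : SGraph U) : Prop :=
  Relation.ReflTransGen (fun S S' => BasicBGStep G S S' ∨ ExpandStep G S S') H G

end SGraph

/-! Everything rests on an invariant of `S` alone, `IsSubdivided`: `S` is finite, has more than
three real nodes, stays connected when one node is deleted, and its real nodes stay mutually joined
when two are deleted. Subdivisions of 3-connected multigraphs have it. If all degrees are at least
3, every node is real and the invariant says that the graph is 3-connected.

Adding a BG-path preserves the invariant. Only the ends of the path can become real, and two deleted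
nodes can cut such an end off from the real nodes only by blocking its link on both sides.
Conditions (2) and (3) make the other end an escape. An expand operation is two successive BG-paths.
So either kind of sequence leads to a 3-connected `G` when the minimum degree is at least 3.

Conversely, let `G` be 3-connected and let `S`, properly contained in `G`, satisfy the invariant. If
some node of `S` is not real, a path in `G` avoiding the two ends of its link leaves the whole class
of parallel links and contains a basic BG-path. If all nodes are real, a missing edge is itself a
basic BG-path, and a missing node of `G` yields three paths for an expand operation. Each step
enlarges `S` inside the finite graph `G`, so the process ends at `G`. -/

namespace SGraph

variable {U : Type*}

/-! ### Walks, joined nodes and cutting of paths -/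

/-- `u` and `v` are joined by a walk in `T`. -/
def Joined (T : SGraph U) (u v : U) : Prop := ∃ p : NodeWalk u v, p.toSubgraph ≤ T

theorem encard_pair_le_two (p q : U) : ({p, q} : Set U).encard ≤ 2 := by
  refine (Set.encard_insert_le {q} p).trans ?_
  rw [Set.encard_singleton, one_add_one_eq_two]

theorem toSubgraph_le_of {T : SGraph U} {u v : U} {p : NodeWalk u v}
    (h1 : ∀ z ∈ p.support, z ∈ T.verts) (h2 : ∀ a b, p.toSubgraph.Adj a b → T.Adj a b) :
    p.toSubgraph ≤ T :=
  ⟨fun z hz => h1 z ((p.mem_verts_toSubgraph).1 hz), fun a b h => h2 a b h⟩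

theorem mem_of_mem_support {T : SGraph U} {u v z : U} {p : NodeWalk u v}
    (h : p.toSubgraph ≤ T) (hz : z ∈ p.support) : z ∈ T.verts :=
  h.1 ((p.mem_verts_toSubgraph).2 hz)

theorem toSubgraph_le_deleteVerts_iff {T : SGraph U} {X : Set U} {u v : U} {p : NodeWalk u v} :
    p.toSubgraph ≤ T.deleteVerts X ↔ p.toSubgraph ≤ T ∧ ∀ z ∈ p.support, z ∉ X := by
  constructor
  · intro h
    exact ⟨h.trans SimpleGraph.Subgraph.deleteVerts_le, fun z hz => (mem_of_mem_support h hz).2⟩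
  · rintro ⟨h, hX⟩
    refine toSubgraph_le_of (fun z hz => ⟨mem_of_mem_support h hz, hX z hz⟩) fun a b hab => ?_
    have ha := (p.mem_verts_toSubgraph).1 hab.fst_mem
    have hb := (p.mem_verts_toSubgraph).1 hab.snd_mem
    exact SimpleGraph.Subgraph.deleteVerts_adj.2
      ⟨mem_of_mem_support h ha, hX a ha, mem_of_mem_support h hb, hX b hb, h.2 hab⟩

theorem nil_toSubgraph_le {T : SGraph U} {u : U} (hu : u ∈ T.verts) :
    (SimpleGraph.Walk.nil : NodeWalk u u).toSubgraph ≤ T := by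
  simpa [SimpleGraph.Walk.toSubgraph] using hu

theorem cons_toSubgraph_le_iff {T : SGraph U} {u v w : U} {h : (⊤ : SimpleGraph U).Adj u v}
    {p : NodeWalk v w} :
    (SimpleGraph.Walk.cons h p).toSubgraph ≤ T ↔ T.Adj u v ∧ p.toSubgraph ≤ T := by
  simp only [SimpleGraph.Walk.toSubgraph, sup_le_iff]
  refine and_congr_left fun _ => ⟨fun hle => hle.2 (by simp), fun hadj => ?_⟩
  exact SimpleGraph.subgraphOfAdj_le_of_adj T hadj

theorem reverse_toSubgraph_le {T : SGraph U} {u v : U} {p : NodeWalk u v}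
    (h : p.toSubgraph ≤ T) : p.reverse.toSubgraph ≤ T := by
  rwa [SimpleGraph.Walk.toSubgraph_reverse]

theorem append_toSubgraph_le {T : SGraph U} {u v w : U} {p : NodeWalk u v} {q : NodeWalk v w}
    (hp : p.toSubgraph ≤ T) (hq : q.toSubgraph ≤ T) : (p.append q).toSubgraph ≤ T := by
  rw [SimpleGraph.Walk.toSubgraph_append]; exact sup_le hp hq

open Classical in
theorem takeUntil_toSubgraph_le {u v z : U} (p : NodeWalk u v) (hz : z ∈ p.support) :
    (p.takeUntil z hz).toSubgraph ≤ p.toSubgraph := by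
  conv_rhs => rw [← p.take_spec hz, SimpleGraph.Walk.toSubgraph_append]
  exact le_sup_left

open Classical in
theorem dropUntil_toSubgraph_le {u v z : U} (p : NodeWalk u v) (hz : z ∈ p.support) :
    (p.dropUntil z hz).toSubgraph ≤ p.toSubgraph := by
  conv_rhs => rw [← p.take_spec hz, SimpleGraph.Walk.toSubgraph_append]
  exact le_sup_right

namespace Joined

variable {T T' : SGraph U} {u v w : U}

theorem refl (hu : u ∈ T.verts) : Joined T u u := ⟨_, nil_toSubgraph_le hu⟩

theorem symm : Joined T u v → Joined T v u := fun ⟨p, hp⟩ => ⟨p.reverse, reverse_toSubgraph_le hp⟩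

theorem trans : Joined T u v → Joined T v w → Joined T u w :=
  fun ⟨p, hp⟩ ⟨q, hq⟩ => ⟨p.append q, append_toSubgraph_le hp hq⟩

theorem mono (h : T ≤ T') : Joined T u v → Joined T' u v := fun ⟨p, hp⟩ => ⟨p, hp.trans h⟩

/-- A set closed under adjacency is closed under being joined. -/
theorem closed {D : U → Prop} (h : Joined T u v) (hu : D u)
    (hD : ∀ a b, T.Adj a b → D a → D b) : D v := by
  obtain ⟨p, hp⟩ := h
  induction p with
  | nil => exact hu
  | cons h p ih =>
    rw [cons_toSubgraph_le_iff] at hp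
    exact ih (hD _ _ hp.1 hu) hp.2

end Joined

theorem connected_iff {T : SGraph U} :
    T.Connected ↔ T.verts.Nonempty ∧ ∀ u ∈ T.verts, ∀ v ∈ T.verts, Joined T u v := by
  rw [SimpleGraph.Subgraph.connected_iff_forall_exists_walk_subgraph]
  exact and_congr_right fun _ => ⟨fun h u hu v hv => h hu hv, fun h u v hu hv => h u hu v hv⟩

/-- Cutting a walk at its first node in `Z` yields a path. -/
theorem exists_path_first {u v : U} (p : NodeWalk u v) {Z : Set U} (hv : v ∈ Z) :
    ∃ z ∈ Z, ∃ q : NodeWalk u z, q.IsPath ∧ q.toSubgraph ≤ p.toSubgraph ∧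
      ∀ w ∈ q.support, w ∈ Z → w = z := by
  classical
  have key : ∃ z ∈ Z, ∃ q : NodeWalk u z, q.toSubgraph ≤ p.toSubgraph ∧
      ∀ w ∈ q.support, w ∈ Z → w = z := by
    induction p with
    | nil => exact ⟨_, hv, .nil, le_rfl, by simp⟩
    | @cons a b c h p ih =>
      by_cases ha : a ∈ Z
      · exact ⟨a, ha, .nil, nil_toSubgraph_le (by simp), by simp⟩
      · obtain ⟨z, hz, q, hq, hqz⟩ := ih hv
        refine ⟨z, hz, .cons h q, ?_, ?_⟩
        · simp only [SimpleGraph.Walk.toSubgraph]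
          exact sup_le_sup_left hq _
        · intro w hw hwZ
          rw [SimpleGraph.Walk.support_cons, List.mem_cons] at hw
          rcases hw with rfl | hw
          · exact absurd hwZ ha
          · exact hqz w hw hwZ
  obtain ⟨z, hz, q, hq, hqz⟩ := key
  refine ⟨z, hz, q.bypass, q.bypass_isPath,
    SimpleGraph.Walk.toSubgraph_bypass_le_toSubgraph.trans hq, fun w hw => hqz w ?_⟩
  exact q.support_bypass_subset_support hw

theorem isPath_append {u v w : U} {p : NodeWalk u v} {q : NodeWalk v w} (hp : p.IsPath)
    (hq : q.IsPath) (h : ∀ z ∈ p.support, z ∈ q.support → z = v) : (p.append q).IsPath := by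
  rw [SimpleGraph.Walk.isPath_def, SimpleGraph.Walk.support_append, List.nodup_append]
  have hq' := (SimpleGraph.Walk.isPath_def q).1 hq
  rw [← q.cons_tail_support, List.nodup_cons] at hq'
  refine ⟨(SimpleGraph.Walk.isPath_def p).1 hp, hq'.2, fun a ha b hb hab => ?_⟩
  subst hab
  have := h a ha (List.mem_of_mem_tail hb)
  subst this
  exact hq'.1 hb

open Classical in
theorem eq_of_mem_takeUntil_of_mem_dropUntil {u v x z : U} {p : NodeWalk u v} (hp : p.IsPath)
    (hx : x ∈ p.support) (h1 : z ∈ (p.takeUntil x hx).support)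
    (h2 : z ∈ (p.dropUntil x hx).support) : z = x := by
  rw [← p.take_spec hx] at hp
  rw [SimpleGraph.Walk.isPath_def, SimpleGraph.Walk.support_append, List.nodup_append] at hp
  rw [← (p.dropUntil x hx).cons_tail_support, List.mem_cons] at h2
  rcases h2 with h2 | h2
  · exact h2
  · exact absurd rfl (hp.2.2 z h1 z h2)

/-! ### Degrees on paths and real nodes -/

/-- An inner node of a path has exactly two neighbours on it. -/
theorem encard_neighborSet_toSubgraph_of_isInner {a b z : U} {p : NodeWalk a b} (hp : p.IsPath)
    (hz : IsInner z p) : (p.toSubgraph.neighborSet z).encard = 2 := by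
  obtain ⟨hz, hza, hzb⟩ := hz
  obtain ⟨n, rfl, hn⟩ := SimpleGraph.Walk.mem_support_iff_exists_getVert.1 hz
  have h0 : n ≠ 0 := by rintro rfl; simp at hza
  have h1 : n < p.length := lt_of_le_of_ne hn (by rintro rfl; simp at hzb)
  have := hp.ncard_neighborSet_toSubgraph_internal_eq_two h0 h1
  rw [← Set.Finite.cast_ncard_eq p.finite_neighborSet_toSubgraph, this]
  rfl

theorem IsInner.reverse {a b z : U} {p : NodeWalk a b} (h : IsInner z p) : IsInner z p.reverse :=
  ⟨by simpa using h.1, h.2.2, h.2.1⟩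

theorem deg_mono {S T : SGraph U} (h : S ≤ T) (v : U) : deg S v ≤ deg T v :=
  Set.encard_le_encard fun _ hw => h.2 hw

theorem IsReal.mono {S T : SGraph U} (h : S ≤ T) {v : U} (hv : IsReal S v) : IsReal T v :=
  ⟨h.1 hv.1, hv.2.trans (deg_mono h v)⟩

/-- The path already supplies two neighbours, and a node that is not real has degree at most two. -/
theorem neighborSet_eq_of_isInner {S : SGraph U} {a b z : U} {p : NodeWalk a b} (hp : p.IsPath)
    (hpS : p.toSubgraph ≤ S) (hz : IsInner z p) (hr : ¬ IsReal S z) :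
    S.neighborSet z = p.toSubgraph.neighborSet z := by
  have h2 := encard_neighborSet_toSubgraph_of_isInner hp hz
  have hzS : z ∈ S.verts := mem_of_mem_support hpS hz.1
  have h3 : deg S z < 3 := not_le.1 fun h => hr ⟨hzS, h⟩
  have hsub : p.toSubgraph.neighborSet z ⊆ S.neighborSet z := fun w hw => hpS.2 hw
  have hfin : (S.neighborSet z).Finite := Set.encard_lt_top_iff.1 (h3.trans (by decide))
  refine (Set.Finite.eq_of_subset_of_encard_le' hfin hsub ?_).symm
  rw [h2]
  have h3' : (S.neighborSet z).encard < 2 + 1 := by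
    rw [two_add_one_eq_three]; exact h3
  exact Order.le_of_lt_add_one h3'

/-- An inner node of a path that is not real has all its neighbours on the path. -/
theorem mem_support_of_adj_of_isInner {S : SGraph U} {a b z w : U} {p : NodeWalk a b}
    (hp : p.IsPath) (hpS : p.toSubgraph ≤ S) (hz : IsInner z p) (hr : ¬ IsReal S z)
    (h : S.Adj z w) : w ∈ p.support := by
  have : w ∈ p.toSubgraph.neighborSet z := neighborSet_eq_of_isInner hp hpS hz hr ▸ h
  exact (p.mem_verts_toSubgraph).1 (SimpleGraph.Subgraph.Adj.snd_mem this)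

/-! ### Links -/

namespace IsSLink

variable {S : SGraph U} {a b c d x : U} {L : NodeWalk a b} {M : NodeWalk c d}

theorem reverse (h : IsSLink S L) : IsSLink S L.reverse := by
  obtain ⟨h1, h2, h3, h4, h5, h6⟩ := h
  exact ⟨h1.reverse, by simpa using h2, reverse_toSubgraph_le h3, h5, h4,
    fun v hv ha hb => h6 v (by simpa using hv) hb ha⟩

theorem ne (h : IsSLink S L) : a ≠ b := by
  rintro rfl
  have := SimpleGraph.Walk.length_eq_zero_iff.2 (SimpleGraph.Walk.isPath_iff_nil.1 h.1)
  have h2 := h.2.1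
  omega

theorem not_isReal (h : IsSLink S L) (hx : IsInner x L) : ¬ IsReal S x :=
  h.2.2.2.2.2 x hx.1 hx.2.1 hx.2.2

theorem eq_or_eq (h : IsSLink S L) (hx : x ∈ L.support) (hr : IsReal S x) : x = a ∨ x = b := by
  by_contra hc
  push Not at hc
  exact h.not_isReal ⟨hx, hc⟩ hr

theorem isInner (h : IsSLink S L) (hx : x ∈ L.support) (hr : ¬ IsReal S x) : IsInner x L := by
  refine ⟨hx, ?_, ?_⟩
  · rintro rfl; exact hr h.2.2.2.1
  · rintro rfl; exact hr h.2.2.2.2.1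

/-- A walk cannot leave `L` before it meets a real node: a node of `L` that is not real is an inner
node and has all its neighbours on `L`. -/
theorem support_subset_of_walk (h : IsSLink S L) {p : NodeWalk x d} (hp : p.IsPath)
    (hpS : p.toSubgraph ≤ S) (hx : x ∈ L.support) (hr : ∀ z ∈ p.support, z ≠ d → ¬ IsReal S z) :
    ∀ z ∈ p.support, z ∈ L.support := by
  induction p with
  | nil => intro z hz; rw [SimpleGraph.Walk.mem_support_nil_iff] at hz; rwa [hz]
  | @cons x w d hxw p ih =>
    rw [cons_toSubgraph_le_iff] at hpS
    have hxd : x ≠ d := by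
      rintro rfl
      have := SimpleGraph.Walk.isPath_iff_nil.1 hp
      simp at this
    have hw : w ∈ L.support := by
      have hx' := hr x (by simp) hxd
      exact mem_support_of_adj_of_isInner h.1 h.2.2.1 (h.isInner hx hx') hx' hpS.1
    intro z hz
    rw [SimpleGraph.Walk.support_cons, List.mem_cons] at hz
    rcases hz with rfl | hz
    · exact hx
    · exact ih hp.of_cons hpS.2 hw (fun z hz => hr z (by simp [hz])) z hz

/-- Links that share an inner node have the same nodes. -/
theorem support_subset (h : IsSLink S L) (h' : IsSLink S M) (hx : x ∈ L.support)
    (hxM : IsInner x M) : ∀ z ∈ M.support, z ∈ L.support := by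
  classical
  intro z hz
  have e := M.take_spec hxM.1
  have hnd : ∀ w, w ∈ (M.takeUntil x hxM.1).support → w ∈ (M.dropUntil x hxM.1).support → w = x :=
    fun w => eq_of_mem_takeUntil_of_mem_dropUntil h'.1 hxM.1
  rw [← e, SimpleGraph.Walk.mem_support_append_iff] at hz
  rcases hz with hz | hz
  · refine h.support_subset_of_walk (p := (M.takeUntil x hxM.1).reverse)
      (h'.1.takeUntil _).reverse
      (reverse_toSubgraph_le ((takeUntil_toSubgraph_le M hxM.1).trans h'.2.2.1)) hx ?_ z
      (by simpa using hz)
    intro w hw hwc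
    rw [SimpleGraph.Walk.support_reverse, List.mem_reverse] at hw
    refine h'.not_isReal ⟨M.support_takeUntil_subset_support _ hw, hwc, ?_⟩
    rintro rfl
    exact hxM.2.2 (hnd w hw (SimpleGraph.Walk.end_mem_support _)).symm
  · refine h.support_subset_of_walk (p := M.dropUntil x hxM.1) (h'.1.dropUntil _)
      ((dropUntil_toSubgraph_le M hxM.1).trans h'.2.2.1) hx ?_ z hz
    intro w hw hwd
    refine h'.not_isReal ⟨M.support_dropUntil_subset_support _ hw, ?_, hwd⟩
    rintro rfl
    exact hxM.2.1 (hnd w (SimpleGraph.Walk.start_mem_support _) hw).symm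

/-- Links that share an inner node have the same ends. -/
theorem ends_eq (h : IsSLink S L) (h' : IsSLink S M) (hx : x ∈ L.support)
    (hxM : IsInner x M) : (c = a ∧ d = b) ∨ (c = b ∧ d = a) := by
  have hsub := h.support_subset h' hx hxM
  have hne := h'.ne
  rcases h.eq_or_eq (hsub c M.start_mem_support) h'.2.2.2.1 with rfl | rfl <;>
  rcases h.eq_or_eq (hsub d M.end_mem_support) h'.2.2.2.2.1 with rfl | rfl <;> simp_all

end IsSLink

/-! ### The invariant and the existence of links -/

/-- An intrinsic description of the finite subdivisions of 3-connected multigraphs. -/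
structure IsSubdivided (S : SGraph U) : Prop where
  finite : S.verts.Finite
  three_lt_encard : 3 < {v | IsReal S v}.encard
  joined_of_ne : ∀ p u v, u ∈ S.verts → v ∈ S.verts → u ≠ p → v ≠ p →
    Joined (S.deleteVerts {p}) u v
  joined_of_isReal : ∀ p q u v, IsReal S u → IsReal S v → u ∉ ({p, q} : Set U) →
    v ∉ ({p, q} : Set U) → Joined (S.deleteVerts {p, q}) u v

namespace IsSubdivided

variable {S : SGraph U}

theorem exists_isReal (hS : IsSubdivided S) {X : Set U} (hX : X.encard ≤ 3) :
    ∃ r, IsReal S r ∧ r ∉ X := by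
  by_contra! h
  exact absurd (hS.three_lt_encard.trans_le (Set.encard_le_encard fun v hv => h v hv))
    (not_lt.2 hX)

/-- The first edge of a walk in `S - p` from `x` to a real node. Taking a neighbour of `x` for `p`
shows that every node has degree at least two. -/
theorem exists_adj_ne (hS : IsSubdivided S) {x : U} (hx : x ∈ S.verts) (p : U) (hp : x ≠ p) :
    ∃ w, S.Adj x w ∧ w ≠ p := by
  obtain ⟨r, hr, hrX⟩ := hS.exists_isReal (X := {p, x})
    ((encard_pair_le_two p x).trans (by decide))
  simp only [Set.mem_insert_iff, Set.mem_singleton_iff, not_or] at hrX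
  obtain ⟨q, hq⟩ := hS.joined_of_ne p x r hx hr.1 hp hrX.1
  cases q with
  | nil => exact absurd rfl hrX.2
  | @cons _ w _ h q =>
    rw [cons_toSubgraph_le_iff] at hq
    have := SimpleGraph.Subgraph.deleteVerts_adj.1 hq.1
    exact ⟨w, this.2.2.2.2, this.2.2.2.1⟩

end IsSubdivided

theorem length_lt_ncard {S : SGraph U} (hS : S.verts.Finite) {a b : U} {p : NodeWalk a b}
    (hp : p.IsPath) (hpS : p.toSubgraph ≤ S) : p.length < S.verts.ncard := by
  classical
  have h := (SimpleGraph.Walk.isPath_def p).1 hp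
  have h1 : p.support.toFinset.card = p.length + 1 := by
    rw [List.toFinset_card_of_nodup h, SimpleGraph.Walk.length_support]
  have h2 : (p.support.toFinset : Set U).ncard ≤ S.verts.ncard :=
    Set.ncard_le_ncard (fun z hz => mem_of_mem_support hpS (by simpa using hz)) hS
  rw [Set.ncard_coe_finset] at h2
  omega

/-- `p` is a path in `S` with inner node `x` and without real inner nodes. -/
def IsThread (S : SGraph U) (x : U) {a b : U} (p : NodeWalk a b) : Prop :=
  p.IsPath ∧ p.toSubgraph ≤ S ∧ IsInner x p ∧ ∀ z, IsInner z p → ¬ IsReal S z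

theorem IsThread.reverse {S : SGraph U} {x a b : U} {p : NodeWalk a b} (h : IsThread S x p) :
    IsThread S x p.reverse :=
  ⟨h.1.reverse, reverse_toSubgraph_le h.2.1, h.2.2.1.reverse, fun z hz => h.2.2.2 z
    (by simpa using hz.reverse)⟩

/-- A longest thread starts in a real node. -/
theorem IsThread.isReal_of_maximal {S : SGraph U} (hS : IsSubdivided S) {x a b : U}
    {p : NodeWalk a b} (h : IsThread S x p)
    (hmax : ∀ (c d : U) (q : NodeWalk c d), IsThread S x q → q.length ≤ p.length) :
    IsReal S a := by
  by_contra ha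
  obtain ⟨hp, hpS, hx, hin⟩ := h
  cases p with
  | nil => exact hx.2.1 (by simpa using hx.1)
  | @cons _ c _ hac p =>
    set Q := SimpleGraph.Walk.cons hac p with hQ
    have hpc := cons_toSubgraph_le_iff.1 hpS
    obtain ⟨w, hw, hwc⟩ := hS.exists_adj_ne hpc.1.fst_mem c hac.ne
    have hwa : w ≠ a := hw.ne.symm
    have hab : a ≠ b := by
      rintro rfl
      have := SimpleGraph.Walk.isPath_iff_nil.1 hp
      simp [hQ] at this
    have hnotnil : ¬ Q.Nil := by simp [hQ]
    have hna : ∀ z, Q.toSubgraph.Adj a z → z = c := fun z hz => by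
      have := hp.neighborSet_toSubgraph_startpoint hnotnil
      have hz' : z ∈ Q.toSubgraph.neighborSet a := hz
      rw [this] at hz'
      simpa [hQ] using hz'
    by_cases hwQ : w ∈ Q.support
    · by_cases hwb : w = b
      -- The thread closes to a cycle. Without `w` nothing leaves it, since `a` and the inner nodes
      -- are not real; a real node elsewhere then contradicts the connectedness of `S - w`.
      · subst hwb
        obtain ⟨r, hr, hrX⟩ := hS.exists_isReal (X := {w})
          (by rw [Set.encard_singleton]; decide)
        have hrw : r ≠ w := by simpa using hrX
        have hj := hS.joined_of_ne w a r hpc.1.fst_mem hr.1 hab hrw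
        have hD : r ∈ Q.support ∧ r ≠ w := by
          refine hj.closed (D := fun z => z ∈ Q.support ∧ z ≠ w) ⟨Q.start_mem_support, hab⟩ ?_
          rintro y z hyz ⟨hy, hyw⟩
          obtain ⟨-, -, -, hzw, hyz⟩ := SimpleGraph.Subgraph.deleteVerts_adj.1 hyz
          refine ⟨?_, hzw⟩
          by_cases hya : y = a
          · subst hya
            by_contra hzQ
            apply ha
            refine ⟨hyz.fst_mem, ?_⟩
            have hsub : ({c, w, z} : Set U) ⊆ S.neighborSet y := by
              rintro t (rfl | rfl | rfl)
              · exact hpc.1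
              · exact hw
              · exact hyz
            have hzc : z ≠ c := by rintro rfl; exact hzQ (by simp [hQ])
            calc (3 : ℕ∞) = ({c, w, z} : Set U).encard := by
                  rw [Set.encard_eq_three.2 ⟨c, w, z, hwc.symm, hzc.symm, Ne.symm hzw, rfl⟩]
              _ ≤ _ := Set.encard_le_encard hsub
          · have hyI : IsInner y Q := ⟨hy, hya, hyw⟩
            exact mem_support_of_adj_of_isInner hp hpS hyI (hin y hyI) hyz
        by_cases hra : r = a
        · exact ha (hra ▸ hr)
        · exact hin r ⟨hD.1, hra, hD.2⟩ hr
      -- The neighbours of an inner node are its neighbours on `Q`, and on `Q` the start `a` is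
      -- adjacent to `c` only.
      · have hwI : IsInner w Q := ⟨hwQ, hwa, hwb⟩
        have hn := neighborSet_eq_of_isInner hp hpS hwI (hin w hwI)
        have : a ∈ Q.toSubgraph.neighborSet w := hn ▸ hw.symm
        exact hwc (hna w (SimpleGraph.Subgraph.Adj.symm this))
    -- Prepending `w` makes `a` an inner node that is not real, so the result is a longer thread.
    · have hth : IsThread S x (SimpleGraph.Walk.cons (S.adj_sub hw.symm) Q) := by
        refine ⟨hp.cons hwQ, cons_toSubgraph_le_iff.2 ⟨hw.symm, hpS⟩,
          ⟨by simp [hx.1], ?_, hx.2.2⟩, ?_⟩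
        · rintro rfl; exact hwQ hx.1
        · rintro z ⟨hz, hzw, hzb⟩
          rw [SimpleGraph.Walk.support_cons, List.mem_cons] at hz
          rcases hz with rfl | hz
          · exact absurd rfl hzw
          · by_cases hza : z = a
            · exact hza ▸ ha
            · exact hin z ⟨hz, hza, hzb⟩
      have := hmax _ _ _ hth
      simp at this

/-- Every node that is not real is an inner node of a link. -/
theorem IsSubdivided.exists_isSLink {S : SGraph U} (hS : IsSubdivided S) {x : U}
    (hx : x ∈ S.verts) (hr : ¬ IsReal S x) :
    ∃ (a b : U) (L : NodeWalk a b), IsSLink S L ∧ IsInner x L := by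
  obtain ⟨r, hrr, hrX⟩ := hS.exists_isReal (X := {x}) (by rw [Set.encard_singleton]; decide)
  obtain ⟨u, hu, -⟩ := hS.exists_adj_ne hx r (Ne.symm (by simpa using hrX))
  obtain ⟨v, hv, hvu⟩ := hS.exists_adj_ne hx u hu.ne
  let P : ℕ → Prop := fun n => ∃ (a b : U) (p : NodeWalk a b), IsThread S x p ∧ p.length = n
  have hP : ∃ n, P n := by
    refine ⟨2, u, v, .cons (S.adj_sub hu.symm) (.cons (S.adj_sub hv) .nil), ⟨?_, ?_, ?_, ?_⟩, rfl⟩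
    · simp [SimpleGraph.Walk.isPath_def, hu.ne.symm, hv.ne, hvu.symm]
    · exact cons_toSubgraph_le_iff.2 ⟨hu.symm,
        cons_toSubgraph_le_iff.2 ⟨hv, nil_toSubgraph_le hv.snd_mem⟩⟩
    · exact ⟨by simp, hu.ne, hv.ne⟩
    · rintro z ⟨hz, hzu, hzv⟩
      simp only [SimpleGraph.Walk.support_cons, SimpleGraph.Walk.support_nil, List.mem_cons,
        List.not_mem_nil, or_false] at hz
      rcases hz with rfl | rfl | rfl
      · exact absurd rfl hzu
      · exact hr
      · exact absurd rfl hzv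
  have hbdd : BddAbove {n | P n} := ⟨S.verts.ncard, by
    rintro n ⟨a, b, p, hp, rfl⟩
    exact (length_lt_ncard hS.finite hp.1 hp.2.1).le⟩
  obtain ⟨a, b, p, hp, hlen⟩ := Nat.sSup_mem hP hbdd
  have hmax : ∀ (c d : U) (q : NodeWalk c d), IsThread S x q → q.length ≤ p.length :=
    fun c d q hq => hlen ▸ le_csSup hbdd ⟨c, d, q, hq, rfl⟩
  have ha := hp.isReal_of_maximal hS hmax
  have hb := hp.reverse.isReal_of_maximal hS (fun c d q hq => by simpa using hmax c d q hq)
  refine ⟨a, b, p, ⟨hp.1, ?_, hp.2.1, ha, hb, fun v h1 h2 h3 => hp.2.2.2 v ⟨h1, h2, h3⟩⟩, hp.2.2.1⟩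
  cases p with
  | nil => exact absurd (by simpa using hp.2.2.1.1) hp.2.2.1.2.1
  | cons h p => simp

/-- A node that is not real can leave its link, unless `p` and `q` block it on both sides. -/
theorem IsSubdivided.joined_isReal_or {S : SGraph U} (hS : IsSubdivided S) {x p q : U}
    (hx : x ∈ S.verts) (hr : ¬ IsReal S x) (hxp : x ∉ ({p, q} : Set U)) :
    (∃ s, IsReal S s ∧ s ∉ ({p, q} : Set U) ∧ Joined (S.deleteVerts {p, q}) x s) ∨
      ∃ (a b : U) (L : NodeWalk a b), IsSLink S L ∧ IsInner x L ∧ p ∈ L.support ∧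
        q ∈ L.support ∧ p ≠ q := by
  classical
  obtain ⟨a, b, L, hL, hxL⟩ := hS.exists_isSLink hx hr
  by_cases h1 : ∀ z ∈ (L.takeUntil x hxL.1).support, z ∉ ({p, q} : Set U)
  · exact .inl ⟨a, hL.2.2.2.1, h1 a (SimpleGraph.Walk.start_mem_support _),
      Joined.symm ⟨_, toSubgraph_le_deleteVerts_iff.2
        ⟨(takeUntil_toSubgraph_le L hxL.1).trans hL.2.2.1, h1⟩⟩⟩
  by_cases h2 : ∀ z ∈ (L.dropUntil x hxL.1).support, z ∉ ({p, q} : Set U)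
  · exact .inl ⟨b, hL.2.2.2.2.1, h2 b (SimpleGraph.Walk.end_mem_support _),
      ⟨_, toSubgraph_le_deleteVerts_iff.2
        ⟨(dropUntil_toSubgraph_le L hxL.1).trans hL.2.2.1, h2⟩⟩⟩
  right
  push Not at h1 h2
  obtain ⟨s, hs, hsX⟩ := h1
  obtain ⟨t, ht, htX⟩ := h2
  have hst : s ≠ t := by
    rintro rfl
    exact hxp (eq_of_mem_takeUntil_of_mem_dropUntil hL.1 hxL.1 hs ht ▸ hsX)
  have hs' := L.support_takeUntil_subset_support _ hs
  have ht' := L.support_dropUntil_subset_support _ ht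
  refine ⟨a, b, L, hL, hxL, ?_⟩
  rcases hsX with rfl | rfl <;> rcases htX with rfl | rfl <;> simp_all [Ne.symm hst]

/-! ### Adding a BG-path preserves the invariant -/

theorem neighborSet_eq_empty {S : SGraph U} {z : U} (hz : z ∉ S.verts) : S.neighborSet z = ∅ :=
  Set.eq_empty_of_forall_notMem fun _ hw => hz (SimpleGraph.Subgraph.Adj.fst_mem hw)

theorem deg_sup_of_notMem_left {S T : SGraph U} {z : U} (hz : z ∉ S.verts) :
    deg (S ⊔ T) z = deg T z := by
  rw [deg, SimpleGraph.Subgraph.neighborSet_sup, neighborSet_eq_empty hz, Set.empty_union, deg]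

theorem not_isReal_sup_of_isInner {S : SGraph U} {a b z : U} {p : NodeWalk a b} (hp : p.IsPath)
    (hz : IsInner z p) (hzS : z ∉ S.verts) : ¬ IsReal (S ⊔ p.toSubgraph) z := by
  rintro ⟨-, h⟩
  rw [deg_sup_of_notMem_left hzS, deg, encard_neighborSet_toSubgraph_of_isInner hp hz] at h
  exact absurd h (by decide)

theorem isReal_of_isReal_sup {S T : SGraph U} {z : U} (hz : z ∉ T.verts)
    (h : IsReal (S ⊔ T) z) : IsReal S z := by
  obtain ⟨h1, h2⟩ := h
  rw [sup_comm, deg_sup_of_notMem_left hz] at h2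
  exact ⟨h1.resolve_right hz, h2⟩

/-- A node of a path is joined to an end of it, whatever other node is deleted. -/
theorem joined_end_or {T : SGraph U} {x y u p : U} {P : NodeWalk x y} (hP : P.IsPath)
    (hle : P.toSubgraph ≤ T) (hu : u ∈ P.support) (hup : u ≠ p) :
    (x ≠ p ∧ Joined (T.deleteVerts {p}) u x) ∨ (y ≠ p ∧ Joined (T.deleteVerts {p}) u y) := by
  classical
  by_cases h1 : p ∈ (P.takeUntil u hu).support
  · have h2 : p ∉ (P.dropUntil u hu).support := fun h2 =>
      hup (eq_of_mem_takeUntil_of_mem_dropUntil hP hu h1 h2).symm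
    refine .inr ⟨?_, P.dropUntil u hu, toSubgraph_le_deleteVerts_iff.2
      ⟨(dropUntil_toSubgraph_le P hu).trans hle, ?_⟩⟩
    · rintro rfl; exact h2 (SimpleGraph.Walk.end_mem_support _)
    · rintro z hz rfl; exact h2 hz
  · refine .inl ⟨?_, Joined.symm ⟨P.takeUntil u hu, toSubgraph_le_deleteVerts_iff.2
      ⟨(takeUntil_toSubgraph_le P hu).trans hle, ?_⟩⟩⟩
    · rintro rfl; exact h1 (SimpleGraph.Walk.start_mem_support _)
    · rintro z hz rfl; exact h1 hz

namespace IsBGPath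

variable {G S : SGraph U} {x y : U} {P : NodeWalk x y}

theorem reverse (h : IsBGPath G S P) : IsBGPath G S P.reverse where
  isPath := h.isPath.reverse
  ne := h.ne.symm
  le := reverse_toSubgraph_le h.le
  inter_verts := by
    rw [SimpleGraph.Walk.toSubgraph_reverse, h.inter_verts, Set.pair_comm]
  inter_edges := by rw [SimpleGraph.Walk.toSubgraph_reverse, h.inter_edges]
  same_link a b L hL hy hx := (h.same_link a b L hL hx hy).symm
  parallel_links a b L L' hL hL' hc := h.parallel_links a b L' L hL' hL hc.symm

theorem left_mem (h : IsBGPath G S P) : x ∈ S.verts := by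
  have : x ∈ (S ⊓ P.toSubgraph).verts := by rw [h.inter_verts]; simp
  exact this.1

theorem right_mem (h : IsBGPath G S P) : y ∈ S.verts := h.reverse.left_mem

theorem eq_or_eq (h : IsBGPath G S P) {z : U} (hz : z ∈ P.support) (hzS : z ∈ S.verts) :
    z = x ∨ z = y := by
  have : z ∈ (S ⊓ P.toSubgraph).verts := ⟨hzS, (P.mem_verts_toSubgraph).2 hz⟩
  rw [h.inter_verts] at this
  exact this

/-- Nodes off `P` keep their degree, and inner nodes of `P` are new and have degree two. -/
theorem isReal_or (h : IsBGPath G S P) {z : U} (hz : IsReal (S ⊔ P.toSubgraph) z) :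
    IsReal S z ∨ z = x ∨ z = y := by
  by_cases hzP : z ∈ P.support
  · right
    by_contra! hne
    by_cases hzS : z ∈ S.verts
    · rcases h.eq_or_eq hzP hzS with h | h
      · exact hne.1 h
      · exact hne.2 h
    · exact not_isReal_sup_of_isInner h.isPath ⟨hzP, hne⟩ hzS hz
  · exact .inl (isReal_of_isReal_sup (fun h => hzP ((P.mem_verts_toSubgraph).1 h)) hz)

/-- After adding `P`, an end of `P` is joined to a real node, whatever two other nodes are
deleted. -/
theorem joined_isReal (hS : IsSubdivided S) (h : IsBGPath G S P) {p q : U}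
    (hx : x ∉ ({p, q} : Set U)) :
    ∃ s, IsReal S s ∧ s ∉ ({p, q} : Set U) ∧
      Joined ((S ⊔ P.toSubgraph).deleteVerts {p, q}) x s := by
  have hle : S.deleteVerts {p, q} ≤ (S ⊔ P.toSubgraph).deleteVerts {p, q} :=
    SimpleGraph.Subgraph.deleteVerts_mono le_sup_left
  by_cases hxr : IsReal S x
  · exact ⟨x, hxr, hx, Joined.refl ⟨.inl hxr.1, hx⟩⟩
  rcases hS.joined_isReal_or h.left_mem hxr hx with ⟨s, hs, hsX, hj⟩ | hblock
  · exact ⟨s, hs, hsX, hj.mono hle⟩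
  obtain ⟨a, b, L, hL, hxL, hpL, hqL, hpq⟩ := hblock
  have hyL : y ∉ L.support := fun hy => by
    rcases (h.same_link a b L hL hxL.1 hy).1 with e | e
    · exact hxL.2.1 e
    · exact hxL.2.2 e
  have hy : y ∉ ({p, q} : Set U) := by
    rintro (rfl | rfl)
    · exact hyL hpL
    · exact hyL hqL
  have hXS : ∀ z ∈ ({p, q} : Set U), z ∈ S.verts := by
    rintro z (rfl | rfl)
    · exact mem_of_mem_support hL.2.2.1 hpL
    · exact mem_of_mem_support hL.2.2.1 hqL
  -- The deleted nodes lie on `L`, hence in `S`, whereas `P` meets `S` only in its ends, neither of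
  -- which is deleted.
  have hxy : Joined ((S ⊔ P.toSubgraph).deleteVerts {p, q}) x y := by
    refine ⟨P, toSubgraph_le_deleteVerts_iff.2 ⟨le_sup_right, fun z hz hzX => ?_⟩⟩
    rcases h.eq_or_eq hz (hXS z hzX) with rfl | rfl
    · exact hx hzX
    · exact hy hzX
  by_cases hyr : IsReal S y
  · exact ⟨y, hyr, hy, hxy⟩
  rcases hS.joined_isReal_or h.right_mem hyr hy with ⟨s, hs, hsX, hj⟩ | hblock
  · exact ⟨s, hs, hsX, hxy.trans (hj.mono hle)⟩
  exfalso
  obtain ⟨c, d, M, hM, hyM, hpM, hqM, -⟩ := hblock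
  -- A common node of `L` and `M` that is not real would be inner to both, and `y` would lie on `L`.
  -- So `p` and `q`, being distinct, are the two ends of both links, which are therefore parallel,
  -- against condition (3).
  have hreal : ∀ z, z ∈ L.support → z ∈ M.support → IsReal S z := fun z hzL hzM => by
    by_contra hz
    exact hyL (hL.support_subset hM hzL (hM.isInner hzM hz) y hyM.1)
  have hp := hreal p hpL hpM
  have hq := hreal q hqL hqM
  have hends : (c = a ∧ d = b) ∨ (c = b ∧ d = a) := by
    rcases hL.eq_or_eq hpL hp with h1 | h1 <;> rcases hL.eq_or_eq hqL hq with h2 | h2 <;>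
    rcases hM.eq_or_eq hpM hp with h3 | h3 <;> rcases hM.eq_or_eq hqM hq with h4 | h4 <;>
    grind
  rcases hends with ⟨rfl, rfl⟩ | ⟨rfl, rfl⟩
  · exact h.parallel_links _ _ L M hL hM ⟨hxL, hyM⟩
  · exact h.parallel_links _ _ L M.reverse hL hM.reverse ⟨hxL, hyM.reverse⟩

/-- Every node of `S ∪ P` is joined to a node of `S`, whatever other node is deleted. -/
theorem joined_mem (h : IsBGPath G S P) {p u : U} (hu : u ∈ (S ⊔ P.toSubgraph).verts)
    (hup : u ≠ p) :
    ∃ s ∈ S.verts, s ≠ p ∧ Joined ((S ⊔ P.toSubgraph).deleteVerts {p}) u s := by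
  rcases hu with hu | hu
  · exact ⟨u, hu, hup, Joined.refl ⟨.inl hu, hup⟩⟩
  rcases joined_end_or h.isPath le_sup_right ((P.mem_verts_toSubgraph).1 hu) hup with h' | h'
  · exact ⟨x, h.left_mem, h'⟩
  · exact ⟨y, h.right_mem, h'⟩

/-- Every node to be joined is first led to a node of `S`, a real one when two nodes are deleted;
there the invariant of `S` applies. -/
theorem isSubdivided_sup (hS : IsSubdivided S) (h : IsBGPath G S P) :
    IsSubdivided (S ⊔ P.toSubgraph) where
  finite := hS.finite.union (by rw [P.verts_toSubgraph]; exact P.support.finite_toSet)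
  three_lt_encard := hS.three_lt_encard.trans_le
    (Set.encard_le_encard fun _ hv => IsReal.mono le_sup_left hv)
  joined_of_ne p u v hu hv hup hvp := by
    obtain ⟨s, hs, hsp, hus⟩ := h.joined_mem hu hup
    obtain ⟨t, ht, htp, hvt⟩ := h.joined_mem hv hvp
    exact hus.trans (((hS.joined_of_ne p s t hs ht hsp htp).mono
      (SimpleGraph.Subgraph.deleteVerts_mono le_sup_left)).trans hvt.symm)
  joined_of_isReal p q u v hu hv huX hvX := by
    have key : ∀ w, IsReal (S ⊔ P.toSubgraph) w → w ∉ ({p, q} : Set U) →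
        ∃ s, IsReal S s ∧ s ∉ ({p, q} : Set U) ∧
          Joined ((S ⊔ P.toSubgraph).deleteVerts {p, q}) w s := by
      intro w hw hwX
      rcases h.isReal_or hw with hr | rfl | rfl
      · exact ⟨w, hr, hwX, Joined.refl ⟨hw.1, hwX⟩⟩
      · exact h.joined_isReal hS hwX
      · simpa using h.reverse.joined_isReal hS hwX
    obtain ⟨s, hs, hsX, hus⟩ := key u hu huX
    obtain ⟨t, ht, htX, hvt⟩ := key v hv hvX
    exact hus.trans (((hS.joined_of_isReal p q s t hs ht hsX htX).mono
      (SimpleGraph.Subgraph.deleteVerts_mono le_sup_left)).trans hvt.symm)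

end IsBGPath

theorem IsSubdivided.of_bgStep {G S S' : SGraph U} (hS : IsSubdivided S) (h : BGStep G S S') :
    IsSubdivided S' := by
  obtain ⟨x, y, P, hP, rfl⟩ := h
  exact hP.isSubdivided_sup hS

/-! ### Criteria for BG-paths; expand operations as BG-paths -/

/-- Sufficient conditions for a BG-path. -/
theorem isBGPath_of {G S : SGraph U} {x y : U} {P : NodeWalk x y} (hP : P.IsPath) (hne : x ≠ y)
    (hle : P.toSubgraph ≤ G) (hx : x ∈ S.verts) (hy : y ∈ S.verts)
    (hin : ∀ z ∈ P.support, z ∈ S.verts → z = x ∨ z = y)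
    (hadj : ¬ (P.toSubgraph.Adj x y ∧ S.Adj x y))
    (h1 : ∀ (a b : U) (L : NodeWalk a b), IsSLink S L → x ∈ L.support → y ∈ L.support →
      (x = a ∨ x = b) ∧ (y = a ∨ y = b))
    (h2 : ∀ (a b : U) (L L' : NodeWalk a b), IsSLink S L → IsSLink S L' →
      ¬ (IsInner x L ∧ IsInner y L')) : IsBGPath G S P where
  isPath := hP
  ne := hne
  le := hle
  inter_verts := by
    ext z
    constructor
    · rintro ⟨hzS, hzP⟩
      exact hin z ((P.mem_verts_toSubgraph).1 hzP) hzS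
    · rintro (rfl | rfl)
      · exact ⟨hx, P.start_mem_verts_toSubgraph⟩
      · exact ⟨hy, P.end_mem_verts_toSubgraph⟩
  inter_edges := by
    refine Set.eq_empty_of_forall_notMem fun e => ?_
    induction e with
    | h a b =>
      intro hab
      rw [SimpleGraph.Subgraph.mem_edgeSet, SimpleGraph.Subgraph.inf_adj] at hab
      obtain ⟨hS, hPab⟩ := hab
      have hab := hS.ne
      rcases hin a ((P.mem_verts_toSubgraph).1 hPab.fst_mem) hS.fst_mem with rfl | rfl <;>
      rcases hin b ((P.mem_verts_toSubgraph).1 hPab.snd_mem) hS.snd_mem with rfl | rfl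
      · exact hab rfl
      · exact hadj ⟨hPab, hS⟩
      · exact hadj ⟨hPab.symm, hS.symm⟩
      · exact hab rfl
  same_link := h1
  parallel_links := h2

/-- A path between real nodes with all inner nodes outside `S` is a BG-path. -/
theorem isBGPath_of_isReal {G S : SGraph U} {x y : U} {P : NodeWalk x y} (hP : P.IsPath)
    (hne : x ≠ y) (hle : P.toSubgraph ≤ G) (hx : IsReal S x) (hy : IsReal S y)
    (hin : ∀ z ∈ P.support, z ∈ S.verts → z = x ∨ z = y)
    (hadj : ¬ (P.toSubgraph.Adj x y ∧ S.Adj x y)) : IsBGPath G S P :=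
  isBGPath_of hP hne hle hx.1 hy.1 hin hadj
    (fun _ _ _ hL hxL hyL => ⟨hL.eq_or_eq hxL hx, hL.eq_or_eq hyL hy⟩)
    fun _ _ _ _ hL _ h => hL.not_isReal h.1 hx

/-- An expand operation amounts to adding two BG-paths. -/
theorem ExpandStep.reflTransGen {G S S' : SGraph U} (h : ExpandStep G S S') :
    Relation.ReflTransGen (BGStep G) S S' := by
  obtain ⟨v, a, P, hv, ha, hr, hP, hd, rfl⟩ := h
  have hva : ∀ i, v ≠ a i := fun i e => hv (e ▸ (hr i).1)
  have hmem : ∀ i j, a i ∈ (P j).support → a i = a j := fun i j h => (hP j).2.2 _ h (hr i).1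
  set Q := (P 0).reverse.append (P 1) with hQ
  have hQp : Q.IsPath := by
    refine isPath_append (hP 0).1.reverse (hP 1).1 fun z hz hz' => ?_
    exact hd 0 1 (by decide) z (by simpa using hz) hz'
  have hQs : ∀ z, z ∈ Q.support ↔ z ∈ (P 0).support ∨ z ∈ (P 1).support := fun z => by
    rw [hQ, SimpleGraph.Walk.mem_support_append_iff, SimpleGraph.Walk.support_reverse,
      List.mem_reverse]
  have hQS : ∀ z ∈ Q.support, z ∈ S.verts → z = a 0 ∨ z = a 1 := fun z hz hzS => by
    rcases (hQs z).1 hz with h | h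
    · exact .inl ((hP 0).2.2 z h hzS)
    · exact .inr ((hP 1).2.2 z h hzS)
  have hQt : Q.toSubgraph = (P 0).toSubgraph ⊔ (P 1).toSubgraph := by
    rw [hQ, SimpleGraph.Walk.toSubgraph_append, SimpleGraph.Walk.toSubgraph_reverse]
  have hvQ : IsInner v Q := ⟨(hQs v).2 (.inl (P 0).start_mem_support), hva 0, hva 1⟩
  have h01 : a 0 ≠ a 1 := ha.ne (by decide)
  have hvin : ∀ z, IsInner z Q → z ∉ S.verts := fun z hz hzS => by
    rcases hQS z hz.1 hzS with h | h
    · exact hz.2.1 h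
    · exact hz.2.2 h
  have hnadj : ¬ Q.toSubgraph.Adj (a 0) (a 1) := by
    intro hadj
    rw [hQt, SimpleGraph.Subgraph.sup_adj] at hadj
    rcases hadj with h | h
    · exact h01 (hmem 1 0 ((P 0).mem_verts_toSubgraph.1 h.snd_mem)).symm
    · exact h01 (hmem 0 1 ((P 1).mem_verts_toSubgraph.1 h.fst_mem))
  have hB1 : IsBGPath G S Q :=
    isBGPath_of_isReal hQp h01 (hQt ▸ sup_le (hP 0).2.1 (hP 1).2.1) (hr 0) (hr 1) hQS
      fun h => hnadj h.1
  have hr' : ∀ i, IsReal (S ⊔ Q.toSubgraph) (a i) := fun i => (hr i).mono le_sup_left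
  have hlink : IsSLink (S ⊔ Q.toSubgraph) Q := by
    refine ⟨hQp, ?_, le_sup_right, hr' 0, hr' 1, fun z hz h1 h2 =>
      not_isReal_sup_of_isInner hQp ⟨hz, h1, h2⟩ (hvin z ⟨hz, h1, h2⟩)⟩
    rw [Nat.one_le_iff_ne_zero]
    exact fun h => h01 (SimpleGraph.Walk.eq_of_length_eq_zero h)
  have hvr := hlink.not_isReal hvQ
  have ha2 : a 2 ∉ Q.support := fun h => by
    rcases (hQs _).1 h with h | h
    · exact absurd (ha (hmem 2 0 h)) (by decide)
    · exact absurd (ha (hmem 2 1 h)) (by decide)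
  -- After `Q` is added, `v` is an inner node of the link `Q`. Every link through `v` has the nodes
  -- of `Q`, so it misses `a 2`; and `a 2` is real, so it is inner to no link.
  have hB2 : IsBGPath G (S ⊔ Q.toSubgraph) (P 2) := by
    refine isBGPath_of (hP 2).1 (hva 2) (hP 2).2.1 (hlink.2.2.1.1 (Q.mem_verts_toSubgraph.2 hvQ.1))
      (hr' 2).1 ?_ ?_ ?_ ?_
    · rintro z hz (hzS | hzQ)
      · exact .inr ((hP 2).2.2 z hz hzS)
      · rcases (hQs z).1 (Q.mem_verts_toSubgraph.1 hzQ) with h | h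
        · exact .inl (hd 2 0 (by decide) z hz h)
        · exact .inl (hd 2 1 (by decide) z hz h)
    · rintro ⟨-, hadj⟩
      exact ha2 (mem_support_of_adj_of_isInner hQp le_sup_right hvQ hvr hadj)
    · intro c d L hL hvL haL
      exact absurd (hlink.support_subset hL hvQ.1 (hL.isInner hvL hvr) _ haL) ha2
    · intro c d L L' _ hL' h
      exact hL'.not_isReal h.2 (hr' 2)
  refine (Relation.ReflTransGen.single ⟨_, _, Q, hB1, rfl⟩).tail ⟨_, _, P 2, hB2, ?_⟩
  rw [hQt, sup_assoc]
  congr 1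
  refine le_antisymm (iSup_le fun i => ?_) (sup_le (sup_le ?_ ?_) ?_)
  · fin_cases i
    · exact le_sup_left.trans le_sup_left
    · exact le_sup_right.trans le_sup_left
    · exact le_sup_right
  all_goals exact le_iSup (fun i => (P i).toSubgraph) _

/-! ### 3-connected graphs -/

theorem two_le_encard_diff_pair {V : Set U} (hV : 3 < V.encard) (u v : U) :
    2 ≤ (V \ {u, v}).encard := by
  by_contra! h
  have h1 : (V \ {u, v}).encard ≤ 1 := Order.le_of_lt_add_one (by rwa [one_add_one_eq_two])
  have h2 := Set.encard_le_encard_sdiff_add_encard V {u, v}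
  have h3 : V.encard ≤ 1 + 2 := h2.trans (add_le_add h1 (encard_pair_le_two u v))
  exact absurd (hV.trans_le h3) (by decide)

/-- Covers deletions of fewer than two nodes of `G`, with `p = q` or `p`, `q` outside `G`: as there
are more than three nodes, the deleted set can be enlarged to exactly two nodes of `G` other than
`u` and `v`. -/
theorem KConnected.joined {G : SGraph U} (hG : KConnected 3 G) (p q : U) {u v : U}
    (hu : u ∈ G.verts) (hv : v ∈ G.verts) (huX : u ∉ ({p, q} : Set U))
    (hvX : v ∉ ({p, q} : Set U)) : Joined (G.deleteVerts {p, q}) u v := by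
  have hsub : G.verts ∩ {p, q} ⊆ G.verts \ {u, v} := by
    rintro z ⟨hz, hzX⟩
    refine ⟨hz, ?_⟩
    rintro (rfl | rfl)
    · exact huX hzX
    · exact hvX hzX
  obtain ⟨X, hX1, hX2, hX⟩ := Set.exists_superset_subset_encard_eq hsub
    ((Set.encard_le_encard Set.inter_subset_right).trans (encard_pair_le_two p q))
    (two_le_encard_diff_pair (by exact_mod_cast hG.1) u v)
  have hc := hG.2 X (hX2.trans Set.sdiff_subset) (by rw [hX]; rfl)
  have := (connected_iff.1 hc).2 u ⟨hu, fun h => (hX2 h).2 (by simp)⟩ v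
    ⟨hv, fun h => (hX2 h).2 (by simp)⟩
  rw [← SimpleGraph.Subgraph.deleteVerts_inter_verts_left_eq]
  exact this.mono (SimpleGraph.Subgraph.deleteVerts_anti hX1)

/-- Otherwise a set of two nodes containing all neighbours of `v` would separate `v` from a further
node. -/
theorem KConnected.three_le_deg {G : SGraph U} (hG : KConnected 3 G) {v : U}
    (hv : v ∈ G.verts) : 3 ≤ deg G v := by
  by_contra! h
  have h' : (G.neighborSet v).encard ≤ 2 :=
    Order.le_of_lt_add_one (by rwa [two_add_one_eq_three])
  have hsub : G.neighborSet v ⊆ G.verts \ {v, v} := fun z hz =>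
    ⟨SimpleGraph.Subgraph.Adj.snd_mem hz, fun e => by
      have e : z = v := by simpa using e
      exact (SimpleGraph.Subgraph.Adj.ne hz) e.symm⟩
  have h3 : 3 < G.verts.encard := by exact_mod_cast hG.1
  obtain ⟨X, hX1, hX2, hX⟩ := Set.exists_superset_subset_encard_eq hsub h'
    (two_le_encard_diff_pair h3 v v)
  have hc := hG.2 X (hX2.trans Set.sdiff_subset) (by rw [hX]; rfl)
  obtain ⟨w, hw, hwX⟩ : ∃ w ∈ G.verts, w ∉ insert v X := by
    by_contra! hall
    have := (Set.encard_le_encard (show G.verts ⊆ insert v X from hall)).trans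
      (Set.encard_insert_le X v)
    rw [hX, two_add_one_eq_three] at this
    exact absurd (h3.trans_le this) (lt_irrefl _)
  simp only [Set.mem_insert_iff, not_or] at hwX
  have hj := (connected_iff.1 hc).2 v ⟨hv, fun h => (hX2 h).2 (by simp)⟩ w ⟨hw, hwX.2⟩
  refine hwX.1 (hj.closed (D := fun z => z = v) rfl ?_)
  rintro a b hab rfl
  have := SimpleGraph.Subgraph.deleteVerts_adj.1 hab
  exact absurd (hX1 this.2.2.2.2) this.2.2.2.1

theorem KConnected.three_le_minDeg {G : SGraph U} (hG : KConnected 3 G) : 3 ≤ minDeg G :=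
  le_iInf₂ fun _ hv => hG.three_le_deg hv

theorem IsSubdivided.kConnected {G : SGraph U} (hG : IsSubdivided G) (h : 3 ≤ minDeg G) :
    KConnected 3 G := by
  have hr : ∀ v ∈ G.verts, IsReal G v := fun v hv => ⟨hv, h.trans (iInf₂_le v hv)⟩
  refine ⟨?_, fun X _ hX => ?_⟩
  · exact_mod_cast hG.three_lt_encard.trans_le (Set.encard_le_encard fun v hv => hv.1)
  · have hX2 : X.encard = 2 := by
      have : X.encard + 1 = 2 + 1 := by rw [hX, two_add_one_eq_three]; rfl
      exact ENat.add_left_injective_of_ne_top ENat.one_ne_top this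
    obtain ⟨p, q, -, rfl⟩ := Set.encard_eq_two.1 hX2
    rw [connected_iff]
    obtain ⟨r, hrr, hrX⟩ := hG.exists_isReal ((encard_pair_le_two p q).trans (by decide))
    exact ⟨⟨r, hrr.1, hrX⟩, fun u hu v hv =>
      hG.joined_of_isReal p q u v (hr u hu.1) (hr v hv.1) hu.2 hv.2⟩

/-! ### Existence of a further step -/

/-- If `S` has a node that is not real, then there is a basic BG-path. -/
theorem exists_basicBGStep_of_not_isReal {G S : SGraph U} (hG : KConnected 3 G)
    (hS : IsSubdivided S) (hSG : S ≤ G) {x₀ : U} (hx₀ : x₀ ∈ S.verts) (hr : ¬ IsReal S x₀) :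
    ∃ S', BasicBGStep G S S' := by
  obtain ⟨a, b, L₀, hL₀, hx₀L⟩ := hS.exists_isSLink hx₀ hr
  set Z : Set U := {z | ∃ L : NodeWalk a b, IsSLink S L ∧ IsInner z L} with hZ
  obtain ⟨r, hrr, hrX⟩ := hS.exists_isReal (X := {a, b})
    ((encard_pair_le_two a b).trans (by decide))
  have hrZ : r ∉ Z := fun ⟨L, hL, h⟩ => hL.not_isReal h hrr
  obtain ⟨W, hW⟩ := hG.joined a b (hSG.1 hx₀) (hSG.1 hrr.1)
    (by rintro (h | h); exacts [hx₀L.2.1 h, hx₀L.2.2 h]) hrX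
  -- Cutting from the side of `r` makes `x` the only node of `q` in `Z`. Going back from `x` to the
  -- first node of `S` outside `Z` gives `P`, which thus meets `S` in `x` and `y` only.
  obtain ⟨x, hxZ, q, hq, hqW, hqZ⟩ := exists_path_first W.reverse (Z := Z) ⟨L₀, hL₀, hx₀L⟩
  obtain ⟨y, hyZ, P, hP, hPq, hPZ⟩ := exists_path_first q.reverse (Z := S.verts \ Z)
    ⟨hrr.1, hrZ⟩
  rw [SimpleGraph.Walk.toSubgraph_reverse] at hqW hPq
  have hPG := toSubgraph_le_deleteVerts_iff.1 ((hPq.trans hqW).trans hW)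
  obtain ⟨L, hL, hxL⟩ := hxZ
  have hxr := hL.not_isReal hxL
  have hyX := hPG.2 y P.end_mem_support
  simp only [Set.mem_insert_iff, Set.mem_singleton_iff, not_or] at hyX
  have hyL : y ∉ L.support := fun h => hyZ.2 ⟨L, hL, h, hyX⟩
  have hxy : x ≠ y := by rintro rfl; exact hyL hxL.1
  refine ⟨_, x, y, P, isBGPath_of hP hxy hPG.1 (mem_of_mem_support hL.2.2.1 hxL.1) hyZ.1
    ?_ ?_ ?_ ?_, fun M hM => hxr hM.2.2.2.1, rfl⟩
  · intro z hz hzS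
    by_cases hzZ : z ∈ Z
    · refine .inl (hqZ z ?_ hzZ)
      exact q.mem_verts_toSubgraph.1 (hPq.1 (P.mem_verts_toSubgraph.2 hz))
    · exact .inr (hPZ z hz ⟨hzS, hzZ⟩)
  · rintro ⟨-, hadj⟩
    exact hyL (mem_support_of_adj_of_isInner hL.1 hL.2.2.1 hxL hxr hadj)
  · intro c d M hM hxM hyM
    exact absurd (hL.support_subset hM hxL.1 (hM.isInner hxM hxr) y hyM) hyL
  -- `M` contains `x` as an inner node, so it has the ends of `L`; then `M'` is parallel to `L` and
  -- would put `y` into `Z`.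
  · rintro c d M M' hM hM' ⟨hxM, hyM'⟩
    apply hyZ.2
    rcases hL.ends_eq hM hxL.1 hxM with ⟨rfl, rfl⟩ | ⟨rfl, rfl⟩
    · exact ⟨M', hM', hyM'⟩
    · exact ⟨M'.reverse, hM'.reverse, hyM'.reverse⟩

/-- If all nodes of `S` are real, then every additional edge between them is a basic BG-path. -/
theorem basicBGStep_of_adj {G S : SGraph U} (hr : ∀ v ∈ S.verts, IsReal S v) {x y : U}
    (hx : x ∈ S.verts) (hy : y ∈ S.verts) (hxy : G.Adj x y) (hn : ¬ S.Adj x y) :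
    ∃ S', BasicBGStep G S S' := by
  refine ⟨_, x, y, .cons (G.adj_sub hxy) .nil, isBGPath_of_isReal ?_ hxy.ne
    (cons_toSubgraph_le_iff.2 ⟨hxy, nil_toSubgraph_le hxy.snd_mem⟩) (hr x hx) (hr y hy) ?_
    (fun h => hn h.2), ?_, rfl⟩
  · simp [SimpleGraph.Walk.isPath_def, hxy.ne]
  · intro z hz _
    simpa using hz
  · intro L hL
    cases L with
    | nil => exact hL.ne rfl
    -- The second node of a link is real here, so it is an end, and the link begins with an edge of
    -- `S` from `x` to `y`.
    | @cons _ w _ h p =>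
      have hSw := (cons_toSubgraph_le_iff.1 hL.2.2.1).1
      rcases hL.eq_or_eq (x := w) (by simp) (hr w hSw.snd_mem) with rfl | rfl
      · exact hSw.ne rfl
      · exact hn hSw

/-- If all nodes of `S` are real and `S` misses a node of `G`, then an expand operation is
possible. -/
theorem exists_expandStep {G S : SGraph U} (hG : KConnected 3 G) (hS : IsSubdivided S)
    (hSG : S ≤ G) (hr : ∀ v ∈ S.verts, IsReal S v) {v₀ : U} (hv₀ : v₀ ∈ G.verts)
    (hv₀S : v₀ ∉ S.verts) : ∃ S', ExpandStep G S S' := by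
  classical
  -- Paths from `v₀` to `S` can be made to avoid two prescribed nodes of `S`. This gives three
  -- distinct ends, but the paths may still cross.
  have attach : ∀ p ∈ S.verts, ∀ q ∈ S.verts, ∃ s ∈ S.verts, s ∉ ({p, q} : Set U) ∧
      ∃ W : NodeWalk v₀ s, W.IsPath ∧ W.toSubgraph ≤ G ∧
        ∀ z ∈ W.support, z ∈ S.verts → z = s := by
    intro p hp q hq
    obtain ⟨r, hrr, hrX⟩ := hS.exists_isReal ((encard_pair_le_two p q).trans (by decide))
    obtain ⟨W, hW⟩ := hG.joined p q hv₀ (hSG.1 hrr.1)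
      (by rintro (rfl | rfl) <;> exact hv₀S ‹_›) hrX
    obtain ⟨s, hs, W', hW', hle, hfirst⟩ := exists_path_first W hrr.1
    have := toSubgraph_le_deleteVerts_iff.1 (hle.trans hW)
    exact ⟨s, hs, this.2 s W'.end_mem_support, W', hW', this.1, hfirst⟩
  obtain ⟨r, hrr, -⟩ := hS.exists_isReal (X := ∅) (by simp)
  obtain ⟨a₁, ha₁, -, W₁, hW₁, hW₁G, hW₁S⟩ := attach r hrr.1 r hrr.1
  obtain ⟨a₂, ha₂, h21, W₂, hW₂, hW₂G, hW₂S⟩ := attach a₁ ha₁ a₁ ha₁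
  obtain ⟨a₃, ha₃, h3, W₃, hW₃, hW₃G, hW₃S⟩ := attach a₁ ha₁ a₂ ha₂
  simp only [Set.mem_insert_iff, Set.mem_singleton_iff, not_or] at h21 h3
  replace h21 := h21.1
  -- Following `W₂` back from `a₂` to its first node on `W₁`, then `W₁` on to `a₁`, gives a path `Q`
  -- with all inner nodes outside `S`.
  obtain ⟨w, hwW₁, B, hB, hBW₂, hBW₁⟩ := exists_path_first W₂.reverse
    (Z := {z | z ∈ W₁.support}) W₁.start_mem_support
  rw [SimpleGraph.Walk.toSubgraph_reverse] at hBW₂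
  have hBs : ∀ z ∈ B.support, z ∈ W₂.support := fun z hz =>
    W₂.mem_verts_toSubgraph.1 (hBW₂.1 (B.mem_verts_toSubgraph.2 hz))
  have hwS : w ∉ S.verts := fun h =>
    h21 ((hW₂S w (hBs w B.end_mem_support) h).symm.trans (hW₁S w hwW₁ h))
  have hT : ∀ z ∈ (W₁.takeUntil w hwW₁).support, z ∉ S.verts := fun z hz hzS => by
    obtain rfl := hW₁S z (W₁.support_takeUntil_subset_support _ hz) hzS
    exact hwS (eq_of_mem_takeUntil_of_mem_dropUntil hW₁ hwW₁ hz
      (SimpleGraph.Walk.end_mem_support _) ▸ hzS)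
  set Q : NodeWalk a₁ a₂ := (W₁.dropUntil w hwW₁).reverse.append B.reverse with hQ
  have hQp : Q.IsPath := by
    refine isPath_append (hW₁.dropUntil hwW₁).reverse hB.reverse fun z hz hz' => ?_
    exact hBW₁ z (by simpa using hz')
      (W₁.support_dropUntil_subset_support hwW₁ (by simpa using hz))
  have hQG : Q.toSubgraph ≤ G :=
    append_toSubgraph_le (reverse_toSubgraph_le ((dropUntil_toSubgraph_le _ _).trans hW₁G))
      (reverse_toSubgraph_le (hBW₂.trans hW₂G))
  have hQS : ∀ z ∈ Q.support, z ∈ S.verts → z = a₁ ∨ z = a₂ := by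
    intro z hz hzS
    rw [hQ, SimpleGraph.Walk.mem_support_append_iff] at hz
    simp only [SimpleGraph.Walk.support_reverse, List.mem_reverse] at hz
    rcases hz with hz | hz
    · exact .inl (hW₁S z (W₁.support_dropUntil_subset_support hwW₁ hz) hzS)
    · exact .inr (hW₂S z (hBs z hz) hzS)
  have hwQ : w ∈ Q.support := by
    rw [hQ, SimpleGraph.Walk.mem_support_append_iff]
    exact .inr (SimpleGraph.Walk.start_mem_support _)
  -- This walk leads from `a₃` through `v₀` to `w` on `Q` and meets `S` only in `a₃`. Its first node
  -- `v` on `Q` is the centre of the three paths.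
  set R₀ := W₃.reverse.append (W₁.takeUntil w hwW₁) with hR₀
  have hR₀S : ∀ z ∈ R₀.support, z ∈ S.verts → z = a₃ := by
    intro z hz hzS
    rw [hR₀, SimpleGraph.Walk.mem_support_append_iff] at hz
    simp only [SimpleGraph.Walk.support_reverse, List.mem_reverse] at hz
    rcases hz with hz | hz
    · exact hW₃S z hz hzS
    · exact absurd hzS (hT z hz)
  have hR₀G : R₀.toSubgraph ≤ G :=
    append_toSubgraph_le (reverse_toSubgraph_le hW₃G) ((takeUntil_toSubgraph_le _ _).trans hW₁G)
  obtain ⟨v, hvQ, R, hR, hRR₀, hRQ⟩ := exists_path_first R₀ (Z := {z | z ∈ Q.support}) hwQ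
  have hRS : ∀ z ∈ R.support, z ∈ S.verts → z = a₃ := fun z hz =>
    hR₀S z (R₀.mem_verts_toSubgraph.1 (hRR₀.1 (R.mem_verts_toSubgraph.2 hz)))
  have hvS : v ∉ S.verts := fun h => by
    have h3v := hRS v R.end_mem_support h
    rcases hQS v hvQ h with e | e
    · exact h3.1 (h3v.symm.trans e)
    · exact h3.2 (h3v.symm.trans e)
  have hsplit : ∀ z, z ∈ (Q.takeUntil v hvQ).support → z ∈ (Q.dropUntil v hvQ).support → z = v :=
    fun z => eq_of_mem_takeUntil_of_mem_dropUntil hQp hvQ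
  have htQ : ∀ z ∈ (Q.takeUntil v hvQ).support, z ∈ Q.support :=
    fun z hz => Q.support_takeUntil_subset_support _ hz
  have hdQ : ∀ z ∈ (Q.dropUntil v hvQ).support, z ∈ Q.support :=
    fun z hz => Q.support_dropUntil_subset_support _ hz
  let a : Fin 3 → U := ![a₁, a₂, a₃]
  let P : ∀ i, NodeWalk v (a i) := fun
    | 0 => (Q.takeUntil v hvQ).reverse
    | 1 => Q.dropUntil v hvQ
    | 2 => R.reverse
  have m0 : ∀ z, z ∈ (P 0).support ↔ z ∈ (Q.takeUntil v hvQ).support := fun z => by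
    change z ∈ (Q.takeUntil v hvQ).reverse.support ↔ _
    simp
  have m2 : ∀ z, z ∈ (P 2).support ↔ z ∈ R.support := fun z => by
    change z ∈ R.reverse.support ↔ _
    simp
  have d01 : ∀ z, z ∈ (P 0).support → z ∈ (P 1).support → z = v := fun z h h' =>
    hsplit z ((m0 z).1 h) h'
  have d02 : ∀ z, z ∈ (P 0).support → z ∈ (P 2).support → z = v := fun z h h' =>
    hRQ z ((m2 z).1 h') (htQ z ((m0 z).1 h))
  have d12 : ∀ z, z ∈ (P 1).support → z ∈ (P 2).support → z = v := fun z h h' =>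
    hRQ z ((m2 z).1 h') (hdQ z h)
  refine ⟨_, v, a, P, hvS, ?_, ?_, ?_, ?_, rfl⟩
  · intro i j hij
    fin_cases i <;> fin_cases j <;> first | rfl | (exfalso; simp [a] at hij; grind)
  · intro i
    fin_cases i
    exacts [hr _ ha₁, hr _ ha₂, hr _ ha₃]
  · intro i
    fin_cases i
    · refine ⟨(hQp.takeUntil hvQ).reverse,
        reverse_toSubgraph_le ((takeUntil_toSubgraph_le _ _).trans hQG), fun z hz hzS => ?_⟩
      have hz := (m0 z).1 hz
      rcases hQS z (htQ z hz) hzS with e | rfl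
      · exact e
      · exact absurd (hsplit _ hz (SimpleGraph.Walk.end_mem_support _) ▸ hzS) hvS
    · refine ⟨hQp.dropUntil hvQ, (dropUntil_toSubgraph_le _ _).trans hQG, fun z hz hzS => ?_⟩
      rcases hQS z (hdQ z hz) hzS with rfl | e
      · exact absurd (hsplit _ (SimpleGraph.Walk.start_mem_support _) hz ▸ hzS) hvS
      · exact e
    · exact ⟨hR.reverse, reverse_toSubgraph_le (hRR₀.trans hR₀G), fun z hz =>
        hRS z ((m2 z).1 hz)⟩
  · intro i j hij z hz hz'
    fin_cases i <;> fin_cases j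
    · exact absurd rfl hij
    · exact d01 z hz hz'
    · exact d02 z hz hz'
    · exact d01 z hz' hz
    · exact absurd rfl hij
    · exact d12 z hz hz'
    · exact d02 z hz' hz
    · exact d12 z hz' hz
    · exact absurd rfl hij

theorem exists_basicBGStep_or_expandStep {G S : SGraph U} (hG : KConnected 3 G)
    (hS : IsSubdivided S) (hSG : S ≤ G) (hne : S ≠ G) :
    ∃ S', BasicBGStep G S S' ∨ ExpandStep G S S' := by
  by_cases hr : ∀ v ∈ S.verts, IsReal S v
  · by_cases hV : ∃ v ∈ G.verts, v ∉ S.verts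
    · obtain ⟨v, hv, hvS⟩ := hV
      obtain ⟨S', h⟩ := exists_expandStep hG hS hSG hr hv hvS
      exact ⟨S', .inr h⟩
    · push Not at hV
      obtain ⟨x, y, hxy, hn⟩ : ∃ x y, G.Adj x y ∧ ¬ S.Adj x y := by
        by_contra! h
        exact hne (le_antisymm hSG ⟨hV, fun x y => h x y⟩)
      obtain ⟨S', h⟩ := basicBGStep_of_adj hr (hV x hxy.fst_mem) (hV y hxy.snd_mem) hxy hn
      exact ⟨S', .inl h⟩
  · push Not at hr
    obtain ⟨x, hx, hxr⟩ := hr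
    obtain ⟨S', h⟩ := exists_basicBGStep_of_not_isReal hG hS hSG hx hxr
    exact ⟨S', .inl h⟩

/-! ### Construction sequences -/

theorem BasicBGStep.bgStep {G S S' : SGraph U} (h : BasicBGStep G S S') : BGStep G S S' := by
  obtain ⟨x, y, P, hP, -, rfl⟩ := h
  exact ⟨x, y, P, hP, rfl⟩

theorem BGStep.le {G S S' : SGraph U} (h : BGStep G S S') : S ≤ S' := by
  obtain ⟨x, y, P, hP, rfl⟩ := h
  exact le_sup_left

theorem BGStep.le_of_le {G S S' : SGraph U} (h : BGStep G S S') (hS : S ≤ G) : S' ≤ G := by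
  obtain ⟨x, y, P, hP, rfl⟩ := h
  exact sup_le hS hP.le

theorem BGStep.ne {G S S' : SGraph U} (h : BGStep G S S') : S ≠ S' := by
  obtain ⟨x, y, P, hP, rfl⟩ := h
  intro he
  have hPS : P.toSubgraph ≤ S := by rw [he]; exact le_sup_right
  cases P with
  | nil => exact hP.ne rfl
  | @cons _ w _ hxw P =>
    have hadj := (cons_toSubgraph_le_iff.1 (le_refl (SimpleGraph.Walk.cons hxw P).toSubgraph)).1
    have : s(x, w) ∈ (S ⊓ (SimpleGraph.Walk.cons hxw P).toSubgraph).edgeSet :=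
      ⟨hPS.2 hadj, hadj⟩
    rw [hP.inter_edges] at this
    exact this

theorem reflTransGen_bgStep_of_step {G S S' : SGraph U}
    (h : BasicBGStep G S S' ∨ ExpandStep G S S') : Relation.ReflTransGen (BGStep G) S S' :=
  h.elim (fun h => .single h.bgStep) ExpandStep.reflTransGen

theorem HasConstructionSeq.le {H G : SGraph U} (h : HasConstructionSeq H G) : H ≤ G := by
  suffices ∀ S, Relation.ReflTransGen (BGStep G) H S → H ≤ S from this G h
  intro S hS
  induction hS with
  | refl => exact le_rfl
  | tail _ h ih => exact ih.trans h.le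

theorem HasBasicExpandConstructionSeq.hasConstructionSeq {H G : SGraph U}
    (h : HasBasicExpandConstructionSeq H G) : HasConstructionSeq H G := by
  suffices ∀ S, Relation.ReflTransGen (fun S S' => BasicBGStep G S S' ∨ ExpandStep G S S') H S →
    Relation.ReflTransGen (BGStep G) H S from this G h
  intro S hS
  induction hS with
  | refl => exact .refl
  | tail _ h ih => exact ih.trans (reflTransGen_bgStep_of_step h)

theorem IsSubdivided.of_reflTransGen {G S S' : SGraph U} (hS : IsSubdivided S)
    (h : Relation.ReflTransGen (BGStep G) S S') : IsSubdivided S' := by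
  induction h with
  | refl => exact hS
  | tail _ h ih => exact ih.of_bgStep h

theorem lt_and_le_of_step {G S S' : SGraph U} (hS : S ≤ G)
    (h : BasicBGStep G S S' ∨ ExpandStep G S S') : S < S' ∧ S' ≤ G := by
  rcases h with h | ⟨v, a, P, hv, -, -, hP, -, rfl⟩
  · exact ⟨lt_of_le_of_ne h.bgStep.le h.bgStep.ne, h.bgStep.le_of_le hS⟩
  · refine ⟨lt_of_le_of_ne le_sup_left fun he => hv ?_, sup_le hS (iSup_le fun i => (hP i).2.1)⟩
    have hle : (P 0).toSubgraph ≤ S := by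
      conv_rhs => rw [he]
      exact (le_iSup (fun i => (P i).toSubgraph) 0).trans le_sup_right
    exact mem_of_mem_support hle (P 0).start_mem_support

theorem finite_Iic {G : SGraph U} (hG : G.verts.Finite) : (Set.Iic G).Finite := by
  let f : SGraph U → Set U × Set (U × U) := fun S => (S.verts, {e | S.Adj e.1 e.2})
  have hf : Function.Injective f := fun S T h => by
    obtain ⟨h1, h2⟩ := Prod.ext_iff.1 h
    refine SimpleGraph.Subgraph.ext h1 ?_
    ext a b
    exact Set.ext_iff.1 h2 (a, b)
  refine Set.Finite.of_finite_image ?_ hf.injOn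
  refine ((hG.finite_subsets).prod ((hG.prod hG).finite_subsets)).subset ?_
  rintro _ ⟨S, hS, rfl⟩
  exact ⟨hS.1, fun e he => ⟨hS.1 (SimpleGraph.Subgraph.Adj.fst_mem he),
    hS.1 (SimpleGraph.Subgraph.Adj.snd_mem he)⟩⟩

/-- Steps strictly enlarge `S` within the finitely many subgraphs of `G`, so induction along `>`
applies. -/
theorem KConnected.hasBasicExpandConstructionSeq {G H : SGraph U} (hfin : G.verts.Finite)
    (hG : KConnected 3 G) (hH : IsSubdivided H) (hHG : H ≤ G) :
    HasBasicExpandConstructionSeq H G := by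
  have hwf : (Set.Iic G).WellFoundedOn (· > ·) := (finite_Iic hfin).wellFoundedOn
  refine hwf.induction (P := fun S => IsSubdivided S → HasBasicExpandConstructionSeq S G) hHG
    (fun S hSG ih hS => ?_) hH
  by_cases hne : S = G
  · exact hne ▸ .refl
  obtain ⟨S', h⟩ := exists_basicBGStep_or_expandStep hG hS hSG hne
  obtain ⟨hlt, hle⟩ := lt_and_le_of_step hSG h
  exact Relation.ReflTransGen.head h
    (ih S' hle hlt (hS.of_reflTransGen (reflTransGen_bgStep_of_step h)))

/-! ### Subdivisions of 3-connected multigraphs satisfy the invariant -/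

variable {W F : Type*} {H : SGraph U} {K : Graph W F} {φ : W → U} {P : F → SGraph U}

/-- The paths `P e` replace the edges `e` of `K` in `H`, where `φ` embeds the nodes of `K`. -/
structure IsSubdivisionBy (H : SGraph U) (K : Graph W F) (φ : W → U) (P : F → SGraph U) :
    Prop where
  injOn : Set.InjOn φ K.vertexSet
  isPath : ∀ e x y, K.IsLink e x y → ∃ p : NodeWalk (φ x) (φ y), p.IsPath ∧ p.toSubgraph = P e
  inc : ∀ e ∈ K.edgeSet, ∀ z ∈ K.vertexSet, φ z ∈ (P e).verts → K.Inc e z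
  disjoint : ∀ e ∈ K.edgeSet, ∀ f ∈ K.edgeSet, e ≠ f →
    (P e).verts ∩ (P f).verts ⊆ φ '' K.vertexSet ∧ Disjoint (P e).edgeSet (P f).edgeSet
  verts_eq : H.verts = φ '' K.vertexSet ∪ ⋃ e ∈ K.edgeSet, (P e).verts
  adj_iff : ∀ a b, H.Adj a b ↔ ∃ e ∈ K.edgeSet, (P e).Adj a b

namespace IsSubdivisionBy

theorem le (h : IsSubdivisionBy H K φ P) {e : F} (he : e ∈ K.edgeSet) : P e ≤ H :=
  ⟨fun z hz => by rw [h.verts_eq]; exact .inr (Set.mem_biUnion he hz),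
    fun a b hab => (h.adj_iff a b).2 ⟨e, he, hab⟩⟩

theorem map_mem (h : IsSubdivisionBy H K φ P) {z : W} (hz : z ∈ K.vertexSet) : φ z ∈ H.verts := by
  rw [h.verts_eq]; exact .inl ⟨z, hz, rfl⟩

theorem exists_isInner (h : IsSubdivisionBy H K φ P) {u : U} (hu : u ∈ H.verts)
    (hn : u ∉ φ '' K.vertexSet) :
    ∃ e x y, K.IsLink e x y ∧ ∃ p : NodeWalk (φ x) (φ y), p.IsPath ∧ p.toSubgraph = P e ∧
      IsInner u p := by
  rw [h.verts_eq] at hu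
  obtain ⟨e, he, hue⟩ := Set.mem_iUnion₂.1 (hu.resolve_left hn)
  obtain ⟨x, y, hxy⟩ := K.exists_isLink_of_mem_edgeSet he
  obtain ⟨p, hp, hpe⟩ := h.isPath e x y hxy
  refine ⟨e, x, y, hxy, p, hp, hpe, p.mem_verts_toSubgraph.1 (hpe ▸ hue), ?_, ?_⟩
  · rintro rfl; exact hn ⟨x, hxy.left_mem, rfl⟩
  · rintro rfl; exact hn ⟨y, hxy.right_mem, rfl⟩

/-- To each neighbour of `z` corresponds the first node after `φ z` on the path of a connecting
edge. These are distinct, because paths of distinct edges share no edge. -/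
theorem isReal_map [K.Loopless] (h : IsSubdivisionBy H K φ P) (hK : MultiKConnected 3 K) {z : W}
    (hz : z ∈ K.vertexSet) : IsReal H (φ z) := by
  refine ⟨h.map_mem hz, le_trans (KConnected.three_le_deg hK hz) ?_⟩
  have key : ∀ w ∈ (underlying K).neighborSet z, ∃ n e, K.IsLink e z w ∧ (P e).Adj (φ z) n := by
    rintro w ⟨hne, e, he⟩
    obtain ⟨p, -, hpe⟩ := h.isPath e z w he
    have hzw : φ z ≠ φ w := fun hc => hne (h.injOn he.left_mem he.right_mem hc)
    exact ⟨p.snd, e, he, hpe ▸ p.toSubgraph_adj_snd (SimpleGraph.Walk.not_nil_of_ne hzw)⟩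
  have : Nonempty U := ⟨φ z⟩
  choose! n hn using key
  refine Set.encard_le_encard_of_injOn (f := n) ?_ ?_
  · intro w hw
    obtain ⟨e, he, hadj⟩ := hn w hw
    exact (h.adj_iff _ _).2 ⟨e, he.edge_mem, hadj⟩
  · intro w hw w' hw' hww
    obtain ⟨e, he, hadj⟩ := hn w hw
    obtain ⟨f, hf, hadj'⟩ := hn w' hw'
    rw [← hww] at hadj'
    have hef : e = f := by
      by_contra hef
      exact Set.disjoint_left.1 (h.disjoint e he.edge_mem f hf.edge_mem hef).2
        (SimpleGraph.Subgraph.mem_edgeSet.2 hadj) (SimpleGraph.Subgraph.mem_edgeSet.2 hadj')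
    subst hef
    exact he.right_unique hf

theorem mem_image_of_isReal (h : IsSubdivisionBy H K φ P) {u : U} (hu : IsReal H u) :
    u ∈ φ '' K.vertexSet := by
  by_contra hn
  obtain ⟨e, x, y, hxy, p, hp, hpe, hin⟩ := h.exists_isInner hu.1 hn
  have hsub : H.neighborSet u ⊆ p.toSubgraph.neighborSet u := by
    intro w hw
    obtain ⟨f, hf, hadj⟩ := (h.adj_iff u w).1 hw
    by_cases hef : e = f
    · subst hef
      exact hpe ▸ hadj
    · exact absurd ((h.disjoint e hxy.edge_mem f hf hef).1
        ⟨hpe ▸ p.mem_verts_toSubgraph.2 hin.1, hadj.fst_mem⟩) hn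
  have := hu.2.trans (Set.encard_le_encard hsub)
  rw [encard_neighborSet_toSubgraph_of_isInner hp hin] at this
  exact absurd this (by decide)

/-- Deleting `p` from `H` affects only edges of `K` with the ends `c` and `c'` or, if `p`
represents a node of `K`, edges incident with this node `c = c'`. -/
theorem exists_inc (h : IsSubdivisionBy H K φ P) [K.Loopless] (hK : MultiKConnected 3 K) (p : U) :
    ∃ c c', (∀ e ∈ K.edgeSet, p ∈ (P e).verts → K.Inc e c ∧ K.Inc e c') ∧
      (∀ z ∈ K.vertexSet, φ z = p → c = z ∧ c' = z) ∧ (c = c' → φ c = p) := by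
  by_cases hp : p ∈ φ '' K.vertexSet
  · obtain ⟨z, hz, rfl⟩ := hp
    exact ⟨z, z, fun e he hze => ⟨h.inc e he z hz hze, h.inc e he z hz hze⟩,
      fun w hw hwz => ⟨h.injOn hz hw hwz.symm, h.injOn hz hw hwz.symm⟩, fun _ => rfl⟩
  have hz : ∀ z ∈ K.vertexSet, φ z ≠ p := fun z hz e => hp ⟨z, hz, e⟩
  by_cases hpH : p ∈ H.verts
  · obtain ⟨e, x, y, hxy, q, hq, hqe, hin⟩ := h.exists_isInner hpH hp
    refine ⟨x, y, fun f hf hpf => ?_, fun z hz' e => absurd e (hz z hz'),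
      fun e => absurd e hxy.ne⟩
    obtain rfl : e = f := by
      by_contra hef
      exact hp ((h.disjoint e hxy.edge_mem f hf hef).1
        ⟨hqe ▸ q.mem_verts_toSubgraph.2 hin.1, hpf⟩)
    exact ⟨⟨y, hxy⟩, ⟨x, hxy.symm⟩⟩
  -- If `p` is not in `H`, any two distinct nodes will do; distinctness makes the last condition
  -- vacuous.
  · have h3 : 3 < K.vertexSet.encard := by exact_mod_cast hK.1
    obtain ⟨c, hc, c', hc', hcc⟩ := (Set.one_lt_encard_iff_nontrivial.1
      (lt_trans (by decide) h3))
    exact ⟨c, c', fun e he hpe => absurd ((h.le he).1 hpe) hpH,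
      fun z hz' e => absurd e (hz z hz'), fun e => absurd e hcc⟩

/-- A walk in `K - {s, t}` lifts to `H`: it uses no edge incident with `s` or `t`, hence no path
containing `p` or `q`. -/
theorem joined_map_of_avoid (h : IsSubdivisionBy H K φ P) (hK : MultiKConnected 3 K) {p q : U}
    {s t u v : W} (hp : ∀ e ∈ K.edgeSet, p ∈ (P e).verts → K.Inc e s)
    (hq : ∀ e ∈ K.edgeSet, q ∈ (P e).verts → K.Inc e t) (hu : u ∈ K.vertexSet)
    (hv : v ∈ K.vertexSet) (huX : φ u ∉ ({p, q} : Set U)) (hus : u ∉ ({s, t} : Set W))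
    (hvs : v ∉ ({s, t} : Set W)) : Joined (H.deleteVerts {p, q}) (φ u) (φ v) := by
  have hj := KConnected.joined hK s t hu hv hus hvs
  refine hj.closed (D := fun z => Joined (H.deleteVerts {p, q}) (φ u) (φ z))
    (Joined.refl ⟨h.map_mem hu, huX⟩) fun a b hab ha => ha.trans ?_
  obtain ⟨-, has, -, hbs, -, e, he⟩ := SimpleGraph.Subgraph.deleteVerts_adj.1 hab
  obtain ⟨r, -, hre⟩ := h.isPath e a b he
  refine ⟨r, toSubgraph_le_deleteVerts_iff.2 ⟨hre ▸ h.le he.edge_mem, fun z hz hzX => ?_⟩⟩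
  have hze : z ∈ (P e).verts := hre ▸ r.mem_verts_toSubgraph.2 hz
  rcases hzX with rfl | rfl
  · obtain ⟨w, hw⟩ := hp e he.edge_mem hze
    rcases hw.left_eq_or_eq he with rfl | rfl
    · exact has (.inl rfl)
    · exact hbs (.inl rfl)
  · obtain ⟨w, hw⟩ := hq e he.edge_mem hze
    rcases hw.left_eq_or_eq he with rfl | rfl
    · exact has (.inr rfl)
    · exact hbs (.inr rfl)

/-- Deleting `p` from `H` is simulated in `K` by deleting `c` or `c'`, and deleting `q` by `d` or
`d'`. If one can choose both away from `u` and `v`, the walk lifts directly; otherwise a third node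
of `K` serves as an intermediate stop. -/
theorem joined_map [K.Loopless] (h : IsSubdivisionBy H K φ P) (hK : MultiKConnected 3 K)
    {p q : U} {u v : W} (hu : u ∈ K.vertexSet) (hv : v ∈ K.vertexSet)
    (huX : φ u ∉ ({p, q} : Set U)) (hvX : φ v ∉ ({p, q} : Set U)) :
    Joined (H.deleteVerts {p, q}) (φ u) (φ v) := by
  obtain ⟨c, c', hc, hcz, hcc⟩ := h.exists_inc hK p
  obtain ⟨d, d', hd, hdz, hdd⟩ := h.exists_inc hK q
  have good : ∀ x ∈ K.vertexSet, ∀ y ∈ K.vertexSet, φ x ∉ ({p, q} : Set U) →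
      (∃ s, (s = c ∨ s = c') ∧ s ≠ x ∧ s ≠ y) → (∃ t, (t = d ∨ t = d') ∧ t ≠ x ∧ t ≠ y) →
      Joined (H.deleteVerts {p, q}) (φ x) (φ y) := by
    rintro x hx y hy hxX ⟨s, hs, hsx, hsy⟩ ⟨t, ht, htx, hty⟩
    refine h.joined_map_of_avoid hK (s := s) (t := t) (fun e he hpe => ?_) (fun e he hqe => ?_)
      hx hy hxX ?_ ?_
    · rcases hs with rfl | rfl
      exacts [(hc e he hpe).1, (hc e he hpe).2]
    · rcases ht with rfl | rfl
      exacts [(hd e he hqe).1, (hd e he hqe).2]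
    · rintro (e | e); exacts [hsx e.symm, htx e.symm]
    · rintro (e | e); exacts [hsy e.symm, hty e.symm]
  by_cases huv : u = v
  · subst huv; exact Joined.refl ⟨h.map_mem hu, huX⟩
  have h3 : 3 < K.vertexSet.encard := by exact_mod_cast hK.1
  obtain ⟨w₁, hw₁, w₂, hw₂, hww⟩ := Set.one_lt_encard_iff_nontrivial.1
    (lt_of_lt_of_le (by decide) (two_le_encard_diff_pair h3 u v))
  obtain ⟨hw₁, hw₁X⟩ := hw₁
  obtain ⟨hw₂, hw₂X⟩ := hw₂
  simp only [Set.mem_insert_iff, Set.mem_singleton_iff, not_or] at huX hvX hw₁X hw₂X good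
  have hex : ∀ e e' x y : W, (∃ s, (s = e ∨ s = e') ∧ s ≠ x ∧ s ≠ y) ↔
      (e ≠ x ∧ e ≠ y) ∨ (e' ≠ x ∧ e' ≠ y) := fun e e' x y => by
    simp only [or_and_right, exists_or, exists_eq_left]
  simp only [hex] at good
  by_cases hgood : ((c ≠ u ∧ c ≠ v) ∨ (c' ≠ u ∧ c' ≠ v)) ∧ ((d ≠ u ∧ d ≠ v) ∨ (d' ≠ u ∧ d' ≠ v))
  · exact good u hu v hv huX hgood.1 hgood.2
  have fc : c = c' → c ≠ u ∧ c ≠ v := fun e =>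
    ⟨fun e' => huX.1 (e' ▸ hcc e), fun e' => hvX.1 (e' ▸ hcc e)⟩
  have fd : d = d' → d ≠ u ∧ d ≠ v := fun e =>
    ⟨fun e' => huX.2 (e' ▸ hdd e), fun e' => hvX.2 (e' ▸ hdd e)⟩
  have hc₁ := hcz w₁ hw₁
  have hc₂ := hcz w₂ hw₂
  have hd₁ := hdz w₁ hw₁
  have hd₂ := hdz w₂ hw₂
  -- Now one pair, say `c, c'`, is `{u, v}`. A candidate outside both pairs works; if neither
  -- candidate is outside, `d, d'` are `w₁, w₂`, and `w₁` works with `w₂` deleted for `q`. On each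
  -- leg the end of `{u, v}` not in use is deleted for `p`.
  have detour : ∃ w ∈ K.vertexSet, (¬ φ w = p ∧ ¬ φ w = q) ∧
      ((c ≠ u ∧ c ≠ w) ∨ (c' ≠ u ∧ c' ≠ w)) ∧ ((d ≠ u ∧ d ≠ w) ∨ (d' ≠ u ∧ d' ≠ w)) ∧
      ((c ≠ w ∧ c ≠ v) ∨ (c' ≠ w ∧ c' ≠ v)) ∧ ((d ≠ w ∧ d ≠ v) ∨ (d' ≠ w ∧ d' ≠ v)) := by
    clear good hc hd hex hcc hdd hcz hdz
    by_cases hw : w₁ = c ∨ w₁ = c' ∨ w₁ = d ∨ w₁ = d'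
    · by_cases hw' : w₂ = c ∨ w₂ = c' ∨ w₂ = d ∨ w₂ = d'
      · exact ⟨w₁, hw₁, by grind⟩
      · exact ⟨w₂, hw₂, by grind⟩
    · exact ⟨w₁, hw₁, by grind⟩
  obtain ⟨w, hw, hwX, g1, g2, g3, g4⟩ := detour
  exact (good u hu w hw huX g1 g2).trans (good w hw v hv hwX g3 g4)

theorem isSubdivided [K.Loopless] (h : IsSubdivisionBy H K φ P) (hK : MultiKConnected 3 K)
    (hfin : H.verts.Finite) : IsSubdivided H where
  finite := hfin
  three_lt_encard := by
    have h3 : 3 < K.vertexSet.encard := by exact_mod_cast hK.1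
    rw [← h.injOn.encard_image] at h3
    refine h3.trans_le (Set.encard_le_encard ?_)
    rintro _ ⟨z, hz, rfl⟩
    exact h.isReal_map hK hz
  joined_of_ne p u v hu hv hup hvp := by
    have key : ∀ w ∈ H.verts, w ≠ p →
        ∃ z ∈ K.vertexSet, φ z ≠ p ∧ Joined (H.deleteVerts {p}) w (φ z) := by
      intro w hw hwp
      by_cases hn : w ∈ φ '' K.vertexSet
      · obtain ⟨z, hz, rfl⟩ := hn
        exact ⟨z, hz, hwp, Joined.refl ⟨hw, hwp⟩⟩
      · obtain ⟨e, x, y, hxy, r, hr, hre, hin⟩ := h.exists_isInner hw hn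
        rcases joined_end_or hr (hre ▸ h.le hxy.edge_mem) hin.1 hwp with h' | h'
        · exact ⟨x, hxy.left_mem, h'⟩
        · exact ⟨y, hxy.right_mem, h'⟩
    obtain ⟨s, hs, hsp, hus⟩ := key u hu hup
    obtain ⟨t, ht, htp, hvt⟩ := key v hv hvp
    -- Deleting one node is the case `q = p`.
    have := h.joined_map hK (p := p) (q := p) hs ht (by simpa using hsp) (by simpa using htp)
    rw [Set.pair_eq_singleton] at this
    exact hus.trans (this.trans hvt.symm)
  joined_of_isReal p q u v hu hv huX hvX := by
    obtain ⟨s, hs, rfl⟩ := h.mem_image_of_isReal hu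
    obtain ⟨t, ht, rfl⟩ := h.mem_image_of_isReal hv
    exact h.joined_map hK hs ht huX hvX

end IsSubdivisionBy

theorem IsSubdivision.isSubdivided [K.Loopless] (h : IsSubdivision H K)
    (hK : MultiKConnected 3 K) (hfin : H.verts.Finite) : IsSubdivided H := by
  obtain ⟨φ, P, h1, h2, h3, h4, h5, h6⟩ := h
  exact IsSubdivisionBy.isSubdivided ⟨h1, h2, h3, h4, h5, h6⟩ hK hfin

end SGraph

/-! ### The equivalences -/

theorem mainTheorem3 {U W F : Type*} (G H : SGraph U) (hG : G.verts.Finite)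
    (K : Graph W F) [K.Loopless] (hK : SGraph.MultiKConnected 3 K)
    (hH : SGraph.IsSubdivision H K) :
    ((SGraph.KConnected 3 G ∧ H ≤ G) ↔
      (3 ≤ SGraph.minDeg G ∧ SGraph.HasConstructionSeq H G)) ∧
    ((SGraph.KConnected 3 G ∧ H ≤ G) ↔
      (3 ≤ SGraph.minDeg G ∧ SGraph.HasBasicExpandConstructionSeq H G)) := by
  have h13 : SGraph.KConnected 3 G ∧ H ≤ G →
      3 ≤ SGraph.minDeg G ∧ SGraph.HasBasicExpandConstructionSeq H G := fun ⟨hc, hle⟩ =>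
    ⟨hc.three_le_minDeg, hc.hasBasicExpandConstructionSeq hG
      (hH.isSubdivided hK (hG.subset hle.1)) hle⟩
  have h32 : 3 ≤ SGraph.minDeg G ∧ SGraph.HasBasicExpandConstructionSeq H G →
      3 ≤ SGraph.minDeg G ∧ SGraph.HasConstructionSeq H G := fun ⟨hd, hs⟩ =>
    ⟨hd, hs.hasConstructionSeq⟩
  have h21 : 3 ≤ SGraph.minDeg G ∧ SGraph.HasConstructionSeq H G →
      SGraph.KConnected 3 G ∧ H ≤ G := fun ⟨hd, hs⟩ =>
    ⟨((hH.isSubdivided hK (hG.subset hs.le.1)).of_reflTransGen hs).kConnected hd, hs.le⟩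
  exact ⟨⟨fun h => h32 (h13 h), h21⟩, ⟨h13, fun h => h21 (h32 h)⟩⟩
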